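/- Let $\mathfrak{g}$ be a finite-dimensional real Lie algebra. Let $[\cdot,\cdot]$ be the algebraic Schouten bracket on $\Lambda\mathfrak{g}$, let $(\Lambda^m\mathfrak{g})^{\mathfrak{g}}=\{q\in\Lambda^m\mathfrak{g}: [v,q]=0\ \forall v\in\mathfrak{g}\}$, let $\mathcal{Y}_\mathfrak{g}=\{r\in\Lambda^2\mathfrak{g}: [r,r]\in(\Lambda^3\mathfrak{g})^{\mathfrak{g}}\}$ be the set of solutions of the modified classical Yang–Baxter equation, and let $\pi_\mathfrak{g}:\Lambda^2\mathfrak{g}\to\Lambda^2_R\mathfrak{g}:=\Lambda^2\mathfrak{g}/(\Lambda^2\mathfrak{g})^{\mathfrak{g}}$ be the projection. A cocommutator is a linear map $\delta:\mathfrak{g}\to\Lambda^2\mathfrak{g}$ such that $(\mathfrak{g},\delta)$ is a Lie bialgebra; for $r\in\Lambda^2\mathfrak{g}$ put $\delta_r(v)=[v,r]$. An $r$-matrix is an $r\in\Lambda^2\mathfrak{g}$ for which $\delta_r$ is a cocommutator, and a coboundary cocommutator is a cocommutator of the form $\delta_r$. Two cocommutators $\delta_1,\delta_2$ are equivalent if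 $\Lambda^2T\circ\delta_1=\delta_2\circ T$ for some Lie algebra automorphism $T\in{\rm Aut}(\mathfrak{g})$. Let ${\rm Aut}(\mathfrak{g})\subset GL(\mathfrak{g})$ act on $\Lambda^2\mathfrak{g}$ by $T\mapsto\Lambda^2T$ and on $\Lambda^2_R\mathfrak{g}$ by the induced maps, let ${\rm Aut}_c(\mathfrak{g})$ be its identity component, and let $\mathscr{E}_\mathfrak{g}$ and $\mathscr{E}^R_\mathfrak{g}$ be the generalised distributions on $\Lambda^2\mathfrak{g}$ and $\Lambda^2_R\mathfrak{g}$ spanned by the fundamental vector fields of these two actions. A generalised distribution $\mathcal{D}$ is integrable if there is a partition of the space into connected immersed submanifolds (strata) $S$ with $T_xS=\mathcal{D}_x$ for all $x\in S$; the members of such a partition are called the strata of $\mathcal{D}$. Then $\mathscr{E}_\mathfrak{g}$ and $\mathscr{E}^R_\mathfrak{g}$ are integrable, each by a unique such partition, and: 1. The classes of $r$-matrices of $\mathfrak{g}$ that are equivalent up to an element of ${\rm Aut}_c(\mathfrak{g})$ are in one-to-one correspondence with the strata of $\mathscr{E}_\mathfrak{g}$ contained in $\mathcal{Y}_\mathfrak{g}$;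 indeed each class, as a subset of $\Lambda^2\mathfrak{g}$, is such a stratum, and every such stratum is a class. 2. The classes of coboundary cocommutators of $\mathfrak{g}$ that are equivalent up to Lie algebra automorphisms of $\mathfrak{g}$ are in one-to-one correspondence with the orbits of ${\rm Aut}(\mathfrak{g})$ on $\pi_\mathfrak{g}(\mathcal{Y}_\mathfrak{g})\subset\Lambda^2_R\mathfrak{g}$, the class $C$ corresponding to the orbit $\{\pi_\mathfrak{g}(r): \delta_r\in C\}$. 3. Every orbit of ${\rm Aut}(\mathfrak{g})$ in $\pi_\mathfrak{g}(\mathcal{Y}_\mathfrak{g})$ is the union of a countable collection of strata of $\mathscr{E}^R_\mathfrak{g}$, all of the same dimension. -/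

import Mathlib

open scoped ContDiff

/-! ### Smooth geometry of a finite-dimensional real vector space -/

section Geometry

variable (E : Type*) [AddCommGroup E] [Module ℝ E] [FiniteDimensional ℝ E]

/-- Linear coordinates on a finite-dimensional real vector space. Topology, smoothness and
derivatives in such a space are always those read in linear coordinates; they do not depend on the
basis. -/
noncomputable def linCoords : E ≃ₗ[ℝ] (Fin (Module.finrank ℝ E) → ℝ) :=
  (Module.finBasis ℝ E).equivFun

variable {E}

/-- The structure of a (second countable) smooth immersed submanifold of `E` on a subset `S`:
a topology on `S` (in general finer than the subspace topology) and charts of `S` with values in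
`ℝ ^ dim`, around every point, such that the inclusion `S → E` is, in the charts, smooth with
injective derivative. (The inclusion is then continuous, so the topology is Hausdorff, and the
transition maps between the charts are smooth.) -/
structure ImmersedSubmanifold (S : Set E) where
  /-- the dimension -/
  dim : ℕ
  /-- the manifold topology -/
  top : TopologicalSpace S
  secondCountable : SecondCountableTopology S
  /-- a chart around every point -/
  chart : S → OpenPartialHomeomorph S (Fin dim → ℝ)
  mem_chart_source : ∀ x : S, x ∈ (chart x).source
  smooth : ∀ x : S,
    ContDiffOn ℝ ∞ (fun t => linCoords E ((chart x).symm t : E)) (chart x).target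
  immersive : ∀ x : S, ∀ t ∈ (chart x).target,
    Function.Injective (fderiv ℝ (fun t => linCoords E ((chart x).symm t : E)) t)

/-- The tangent space at `x` of an immersed submanifold, as a subspace of `E`: the range of the
derivative of the inclusion. -/
noncomputable def ImmersedSubmanifold.tangentSpace {S : Set E} (M : ImmersedSubmanifold S)
    (x : S) : Submodule ℝ E :=
  letI := M.top
  (LinearMap.range
    (fderiv ℝ (fun t => linCoords E ((M.chart x).symm t : E)) (M.chart x x)).toLinearMap).comap
      (linCoords E).toLinearMap

/-- `S` is a connected immersed submanifold of `E`, of dimension `k`, whose tangent space at each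
of its points is the value there of the generalised distribution `D`. -/
def IsConnectedIntegralSubmanifold (D : E → Submodule ℝ E) (k : ℕ) (S : Set E) : Prop :=
  ∃ M : ImmersedSubmanifold S, M.dim = k ∧ @ConnectedSpace S M.top ∧
    ∀ x : S, M.tangentSpace x = D x

/-- `F` is a stratification of `E` (a partition into connected immersed submanifolds) that
integrates the generalised distribution `D`. -/
def IsIntegralStratification (D : E → Submodule ℝ E) (F : Set (Set E)) : Prop :=
  Setoid.IsPartition F ∧ ∀ S ∈ F, ∃ k, IsConnectedIntegralSubmanifold D k S

/-- The strata of the generalised distribution `D`: the members of the stratifications that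
integrate `D`. -/
def strata (D : E → Submodule ℝ E) : Set (Set E) :=
  {S | ∃ F, IsIntegralStratification D F ∧ S ∈ F}

/-- The strata of dimension `k` of the generalised distribution `D`. -/
def strataOfDim (D : E → Submodule ℝ E) (k : ℕ) : Set (Set E) :=
  {S | S ∈ strata D ∧ IsConnectedIntegralSubmanifold D k S}

end Geometry

/-! ### The Schouten bracket, bivectors and cocommutators -/

section Schouten

variable {𝔤 : Type*} [LieRing 𝔤] [LieAlgebra ℝ 𝔤] [FiniteDimensional ℝ 𝔤]

open CliffordAlgebra (contractLeft)

/-- The algebraic Schouten bracket on the Grassmann algebra: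
`[P, Q] = ∑ a b, [e a, e b] ∧ (ι_{e^a} P) ∧ (ι_{e^b} Q)` for a basis `e` with dual basis `e^a`,
where `ι_α (X₁ ∧ … ∧ Xₛ) = ∑ i, (-1)^(i+1) α(Xᵢ) X₁ ∧ … X̂ᵢ … ∧ Xₛ`. That is,
`[X₁ ∧ … ∧ Xₛ, Y₁ ∧ … ∧ Yₗ] = ∑ i j, (-1)^(i+j) [Xᵢ, Yⱼ] ∧ X₁ … X̂ᵢ … Xₛ ∧ Y₁ … Ŷⱼ … Yₗ`;
the lemmas below spell this out in low degrees. -/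
noncomputable def schouten :
    ExteriorAlgebra ℝ 𝔤 →ₗ[ℝ] ExteriorAlgebra ℝ 𝔤 →ₗ[ℝ] ExteriorAlgebra ℝ 𝔤 :=
  ∑ a, ∑ b, (LinearMap.mul ℝ (ExteriorAlgebra ℝ 𝔤)).compl₁₂
    (LinearMap.mulLeft ℝ
        (ExteriorAlgebra.ι ℝ ⁅Module.finBasis ℝ 𝔤 a, Module.finBasis ℝ 𝔤 b⁆) ∘ₗ
      contractLeft ((Module.finBasis ℝ 𝔤).coord a))
    (contractLeft ((Module.finBasis ℝ 𝔤).coord b))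

theorem schouten_apply (P Q : ExteriorAlgebra ℝ 𝔤) :
    schouten P Q = ∑ a, ∑ b,
      ExteriorAlgebra.ι ℝ ⁅Module.finBasis ℝ 𝔤 a, Module.finBasis ℝ 𝔤 b⁆ *
        contractLeft ((Module.finBasis ℝ 𝔤).coord a) P *
        contractLeft ((Module.finBasis ℝ 𝔤).coord b) Q := by
  simp [schouten, LinearMap.sum_apply, LinearMap.compl₁₂_apply]

theorem sum_coord_lie (x y : 𝔤) :
    ∑ a, ∑ b, ((Module.finBasis ℝ 𝔤).coord a x * (Module.finBasis ℝ 𝔤).coord b y) •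
      ⁅Module.finBasis ℝ 𝔤 a, Module.finBasis ℝ 𝔤 b⁆ = ⁅x, y⁆ := by
  conv_rhs => rw [← (Module.finBasis ℝ 𝔤).sum_repr x, ← (Module.finBasis ℝ 𝔤).sum_repr y]
  simp only [lie_sum, sum_lie, lie_smul, smul_lie, Finset.smul_sum, smul_smul,
    Module.Basis.coord_apply]
  rw [Finset.sum_comm]
  simp only [mul_comm]

theorem schouten_ι_apply (v : 𝔤) (Q : ExteriorAlgebra ℝ 𝔤) :
    schouten (ExteriorAlgebra.ι ℝ v) Q = ∑ b,
      ExteriorAlgebra.ι ℝ ⁅v, Module.finBasis ℝ 𝔤 b⁆ *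
        contractLeft ((Module.finBasis ℝ 𝔤).coord b) Q := by
  rw [schouten_apply, Finset.sum_comm]
  refine Finset.sum_congr rfl fun b _ => ?_
  have h : ⁅v, Module.finBasis ℝ 𝔤 b⁆ = ∑ a, (Module.finBasis ℝ 𝔤).coord a v •
      ⁅Module.finBasis ℝ 𝔤 a, Module.finBasis ℝ 𝔤 b⁆ := by
    conv_lhs => rw [← (Module.finBasis ℝ 𝔤).sum_repr v]
    simp only [sum_lie, smul_lie, Module.Basis.coord_apply]
  rw [h, map_sum, Finset.sum_mul]
  refine Finset.sum_congr rfl fun a _ => ?_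
  rw [CliffordAlgebra.contractLeft_ι, ← Algebra.commutes, ← Algebra.smul_def, map_smul]

theorem schouten_ι_algebraMap (v : 𝔤) (c : ℝ) :
    schouten (ExteriorAlgebra.ι ℝ v) (algebraMap ℝ _ c) = 0 := by
  simp [schouten_ι_apply]

/-- `[v, ·]` is the derivation of the Grassmann algebra that extends `ad v`. -/
theorem schouten_ι_ι_mul (v x : 𝔤) (Q : ExteriorAlgebra ℝ 𝔤) :
    schouten (ExteriorAlgebra.ι ℝ v) (ExteriorAlgebra.ι ℝ x * Q) =
      ExteriorAlgebra.ι ℝ ⁅v, x⁆ * Q +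
        ExteriorAlgebra.ι ℝ x * schouten (ExteriorAlgebra.ι ℝ v) Q := by
  have h : ⁅v, x⁆ = ∑ b, (Module.finBasis ℝ 𝔤).coord b x • ⁅v, Module.finBasis ℝ 𝔤 b⁆ := by
    conv_lhs => rw [← (Module.finBasis ℝ 𝔤).sum_repr x]
    simp only [lie_sum, lie_smul, Module.Basis.coord_apply]
  rw [schouten_ι_apply, schouten_ι_apply, h, map_sum, Finset.sum_mul, Finset.mul_sum,
    ← Finset.sum_add_distrib]
  refine Finset.sum_congr rfl fun b _ => ?_
  rw [CliffordAlgebra.contractLeft_ι_mul, mul_sub, ← mul_assoc, ← mul_assoc, map_smul,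
    smul_mul_assoc, mul_smul_comm, sub_eq_add_neg, ← neg_mul]
  congr 2
  exact neg_eq_of_add_eq_zero_right (ExteriorAlgebra.ι_add_mul_swap _ _)

/-- The bracket of two decomposable bivectors. -/
theorem schouten_ι_mul_ι (x₁ x₂ y₁ y₂ : 𝔤) :
    schouten (ExteriorAlgebra.ι ℝ x₁ * ExteriorAlgebra.ι ℝ x₂)
        (ExteriorAlgebra.ι ℝ y₁ * ExteriorAlgebra.ι ℝ y₂) =
      ExteriorAlgebra.ι ℝ ⁅x₁, y₁⁆ * ExteriorAlgebra.ι ℝ x₂ * ExteriorAlgebra.ι ℝ y₂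
      - ExteriorAlgebra.ι ℝ ⁅x₁, y₂⁆ * ExteriorAlgebra.ι ℝ x₂ * ExteriorAlgebra.ι ℝ y₁
      - ExteriorAlgebra.ι ℝ ⁅x₂, y₁⁆ * ExteriorAlgebra.ι ℝ x₁ * ExteriorAlgebra.ι ℝ y₂
      + ExteriorAlgebra.ι ℝ ⁅x₂, y₂⁆ * ExteriorAlgebra.ι ℝ x₁ * ExteriorAlgebra.ι ℝ y₁ := by
  rw [schouten_apply, ← sum_coord_lie x₁ y₁, ← sum_coord_lie x₁ y₂, ← sum_coord_lie x₂ y₁,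
    ← sum_coord_lie x₂ y₂]
  simp only [map_sum, Finset.sum_mul, ← Finset.sum_sub_distrib, ← Finset.sum_add_distrib]
  refine Finset.sum_congr rfl fun a _ => Finset.sum_congr rfl fun b _ => ?_
  simp only [CliffordAlgebra.contractLeft_ι_mul, CliffordAlgebra.contractLeft_ι, map_smul,
    mul_sub, sub_mul, smul_mul_assoc, mul_smul_comm, mul_assoc, ← Algebra.commutes,
    ← Algebra.smul_def, smul_sub, mul_smul]
  module

theorem schouten_ι_mem {n : ℕ} (v : 𝔤) {Q : ExteriorAlgebra ℝ 𝔤} (hQ : Q ∈ ⋀[ℝ]^n 𝔤) :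
    schouten (ExteriorAlgebra.ι ℝ v) Q ∈ ⋀[ℝ]^n 𝔤 := by
  induction hQ using Submodule.pow_induction_on_left' with
  | algebraMap c => rw [schouten_ι_algebraMap]; exact zero_mem _
  | add x y i hx hy h₁ h₂ => rw [map_add]; exact add_mem h₁ h₂
  | mem_mul m hm i x hx h =>
    obtain ⟨u, rfl⟩ := hm
    rw [schouten_ι_ι_mul, Nat.succ_eq_add_one, ExteriorAlgebra.exteriorPower, pow_succ']
    exact add_mem (Submodule.mul_mem_mul ⟨_, rfl⟩ hx) (Submodule.mul_mem_mul ⟨_, rfl⟩ h)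

variable (𝔤) in
/-- The space `Λ²𝔤` of bivectors. -/
abbrev Bivector : Type _ := ⋀[ℝ]^2 𝔤

/-- An element of the Grassmann algebra is `𝔤`-invariant if its brackets with the elements of `𝔤`
vanish. -/
def IsInvariantMultivector (Q : ExteriorAlgebra ℝ 𝔤) : Prop :=
  ∀ v : 𝔤, schouten (ExteriorAlgebra.ι ℝ v) Q = 0

variable (𝔤) in
/-- The space `(Λ²𝔤)^𝔤` of `𝔤`-invariant bivectors. -/
def invariantBivectors : Submodule ℝ (Bivector 𝔤) where
  carrier := {q | IsInvariantMultivector (q : ExteriorAlgebra ℝ 𝔤)}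
  add_mem' := fun {p q} hp hq v => by simp [hp v, hq v]
  zero_mem' := fun v => by simp
  smul_mem' := fun c q hq v => by simp [hq v]

variable (𝔤) in
/-- The quotient `Λ²𝔤 / (Λ²𝔤)^𝔤`; its canonical projection is `(invariantBivectors 𝔤).mkQ`. -/
abbrev ReducedBivector : Type _ := Bivector 𝔤 ⧸ invariantBivectors 𝔤

variable (𝔤) in
/-- The set of solutions `r ∈ Λ²𝔤` of the modified classical Yang-Baxter equation
`[r, r] ∈ (Λ³𝔤)^𝔤`. -/
def mCYBESolutions : Set (Bivector 𝔤) :=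
  {r | schouten (r : ExteriorAlgebra ℝ 𝔤) r ∈ ⋀[ℝ]^3 𝔤 ∧
    IsInvariantMultivector (schouten (r : ExteriorAlgebra ℝ 𝔤) r)}

/-- The bracket on `𝔤*` given by the transpose `δ* : Λ²𝔤* → 𝔤*` of `δ : 𝔤 → Λ²𝔤`. -/
noncomputable def dualBracket (δ : 𝔤 →ₗ[ℝ] Bivector 𝔤) (α β : Module.Dual ℝ 𝔤) :
    Module.Dual ℝ 𝔤 :=
  δ.dualMap (exteriorPower.pairingDual ℝ 𝔤 2 (exteriorPower.ιMulti ℝ 2 ![α, β]))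

/-- `δ` is a cocommutator, i.e. `(𝔤, δ)` is a Lie bialgebra: the transpose of `δ` is a Lie bracket
on `𝔤*` (bilinearity and antisymmetry are automatic) and
`δ [v₁, v₂] = [v₁, δ v₂] + [δ v₁, v₂]`. -/
structure IsCocommutator (δ : 𝔤 →ₗ[ℝ] Bivector 𝔤) : Prop where
  jacobi : ∀ α β γ : Module.Dual ℝ 𝔤,
    dualBracket δ α (dualBracket δ β γ) + dualBracket δ β (dualBracket δ γ α) +
      dualBracket δ γ (dualBracket δ α β) = 0
  cocycle : ∀ v₁ v₂ : 𝔤, (δ ⁅v₁, v₂⁆ : ExteriorAlgebra ℝ 𝔤) =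
    schouten (ExteriorAlgebra.ι ℝ v₁) (δ v₂) + schouten (δ v₁) (ExteriorAlgebra.ι ℝ v₂)

/-- The map `δ_r : v ↦ [v, r]`. -/
noncomputable def coboundary (r : Bivector 𝔤) : 𝔤 →ₗ[ℝ] Bivector 𝔤 :=
  ((schouten.flip (r : ExteriorAlgebra ℝ 𝔤)).comp (ExteriorAlgebra.ι ℝ)).codRestrict (⋀[ℝ]^2 𝔤)
    fun v => schouten_ι_mem v r.2

/-- `r` is an `r`-matrix: `(𝔤, δ_r)` is a (coboundary) Lie bialgebra. -/
def IsRMatrix (r : Bivector 𝔤) : Prop := IsCocommutator (coboundary r)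

/-- `δ` is a coboundary cocommutator. -/
def IsCoboundaryCocommutator (δ : 𝔤 →ₗ[ℝ] Bivector 𝔤) : Prop :=
  IsCocommutator δ ∧ ∃ r : Bivector 𝔤, δ = coboundary r

end Schouten

/-! ### The automorphism group and its actions -/

section Aut

variable (𝔤 : Type*) [LieRing 𝔤] [LieAlgebra ℝ 𝔤]

/-- The group `Aut(𝔤)` of Lie algebra automorphisms, as a subgroup of `GL(𝔤)`. -/
def autGroup : Subgroup (𝔤 ≃ₗ[ℝ] 𝔤) where
  carrier := {T | ∀ x y, T ⁅x, y⁆ = ⁅T x, T y⁆}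
  mul_mem' := fun {S T} hS hT x y => by
    simp only [LinearEquiv.mul_apply, hT x y, hS (T x) (T y)]
  one_mem' := fun _ _ => rfl
  inv_mem' := fun {T} hT x y => by
    apply T.injective
    rw [hT]
    simp

variable {𝔤}

/-- An automorphism as an endomorphism of the vector space `𝔤`. -/
def autToEnd (T : autGroup 𝔤) : Module.End ℝ 𝔤 := (T : 𝔤 ≃ₗ[ℝ] 𝔤).toLinearMap

variable (𝔤) in
/-- The action `T ↦ Λ²T` of `Aut(𝔤)` on `Λ²𝔤`. -/
noncomputable def bivectorAction : Representation ℝ (autGroup 𝔤) (Bivector 𝔤) where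
  toFun T := exteriorPower.map 2 (autToEnd T)
  map_one' := exteriorPower.map_id
  map_mul' S T := exteriorPower.map_comp (autToEnd T) (autToEnd S)

theorem coe_bivectorAction (T : autGroup 𝔤) (q : Bivector 𝔤) :
    (bivectorAction 𝔤 T q : ExteriorAlgebra ℝ 𝔤) =
      ExteriorAlgebra.map (autToEnd T) (q : ExteriorAlgebra ℝ 𝔤) := by
  have h : (⋀[ℝ]^2 𝔤).subtype ∘ₗ exteriorPower.map 2 (autToEnd T) =
      (ExteriorAlgebra.map (autToEnd T)).toLinearMap ∘ₗ (⋀[ℝ]^2 𝔤).subtype := by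
    ext m
    simp
    rfl
  exact LinearMap.congr_fun h q

variable [FiniteDimensional ℝ 𝔤]

/-- The topology of `Aut(𝔤)` as a subset of the finite-dimensional vector space `𝔤𝔩(𝔤)`. -/
noncomputable instance autTopology : TopologicalSpace (autGroup 𝔤) :=
  TopologicalSpace.induced (fun T => linCoords (Module.End ℝ 𝔤) (autToEnd T)) inferInstance

variable (𝔤) in
/-- `Aut_c(𝔤)`, the connected component of the identity in `Aut(𝔤)`. -/
def autConnected : Set (autGroup 𝔤) := connectedComponent 1

/-- A (smooth) one-parameter subgroup of `Aut(𝔤)`. -/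
structure IsOneParameterSubgroup (γ : ℝ → autGroup 𝔤) : Prop where
  map_zero : γ 0 = 1
  map_add : ∀ s t, γ (s + t) = γ s * γ t
  smooth : ContDiff ℝ ∞ fun t => linCoords (Module.End ℝ 𝔤) (autToEnd (γ t))

section Representation

variable {E : Type*} [AddCommGroup E] [Module ℝ E] [FiniteDimensional ℝ E]

/-- The fundamental vector fields on `E` of a linear action `ρ` of `Aut(𝔤)`: the vector fields
`w ↦ d/dt|_{t = 0} ρ(γ t) w` of the one-parameter subgroups `γ` of `Aut(𝔤)`. -/
def fundamentalVectorFields (ρ : Representation ℝ (autGroup 𝔤) E) : Set (E → E) :=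
  {X | ∃ γ, IsOneParameterSubgroup γ ∧
    ∀ w, HasDerivAt (fun t => linCoords E (ρ (γ t) w)) (linCoords E (X w)) 0}

/-- The generalised distribution on `E` spanned by the fundamental vector fields. -/
def fundamentalDistribution (ρ : Representation ℝ (autGroup 𝔤) E) (x : E) : Submodule ℝ E :=
  Submodule.span ℝ {u | ∃ X ∈ fundamentalVectorFields ρ, u = X x}

end Representation

theorem map_schouten_ι (T : autGroup 𝔤) (v : 𝔤) (Q : ExteriorAlgebra ℝ 𝔤) :
    ExteriorAlgebra.map (autToEnd T) (schouten (ExteriorAlgebra.ι ℝ v) Q) =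
      schouten (ExteriorAlgebra.ι ℝ (autToEnd T v)) (ExteriorAlgebra.map (autToEnd T) Q) := by
  have hT : ∀ x y : 𝔤, autToEnd T ⁅x, y⁆ = ⁅autToEnd T x, autToEnd T y⁆ := T.2
  induction Q using CliffordAlgebra.left_induction with
  | algebraMap c => rw [schouten_ι_algebraMap, map_zero, AlgHom.commutes, schouten_ι_algebraMap]
  | add x y hx hy => rw [map_add, map_add, map_add, map_add, hx, hy]
  | ι_mul x m hx =>
    change ExteriorAlgebra.map _ (schouten _ (ExteriorAlgebra.ι ℝ m * x)) =
      schouten _ (ExteriorAlgebra.map _ (ExteriorAlgebra.ι ℝ m * x))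
    rw [schouten_ι_ι_mul, map_add, map_mul (ExteriorAlgebra.map _), map_mul (ExteriorAlgebra.map _),
      map_mul (ExteriorAlgebra.map _), ExteriorAlgebra.map_apply_ι, ExteriorAlgebra.map_apply_ι,
      schouten_ι_ι_mul, hx, hT]

theorem invariantBivectors_le_comap (T : autGroup 𝔤) :
    invariantBivectors 𝔤 ≤ (invariantBivectors 𝔤).comap (bivectorAction 𝔤 T) := by
  intro q hq v
  have hv : autToEnd T (autToEnd T⁻¹ v) = v := LinearEquiv.apply_symm_apply T.1 v
  rw [coe_bivectorAction, ← hv, ← map_schouten_ι, hq, map_zero]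

variable (𝔤) in
/-- The action `T ↦ [Λ²T]` of `Aut(𝔤)` on `Λ²𝔤 / (Λ²𝔤)^𝔤`. -/
noncomputable def reducedAction : Representation ℝ (autGroup 𝔤) (ReducedBivector 𝔤) :=
  (bivectorAction 𝔤).quotient (invariantBivectors 𝔤) invariantBivectors_le_comap

variable (𝔤) in
/-- The classes of `r`-matrices that are equivalent up to an element of `Aut_c(𝔤)`. -/
def rMatrixClasses : Set (Set (Bivector 𝔤)) :=
  {C | ∃ r, IsRMatrix r ∧
    C = {r' | IsRMatrix r' ∧ ∃ T ∈ autConnected 𝔤, bivectorAction 𝔤 T r = r'}}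

/-- Two cocommutators are equivalent up to Lie algebra automorphisms of `𝔤`:
`Λ²T ∘ δ₁ = δ₂ ∘ T` for some `T ∈ Aut(𝔤)`. -/
def CocommutatorEquiv (δ₁ δ₂ : 𝔤 →ₗ[ℝ] Bivector 𝔤) : Prop :=
  ∃ T : autGroup 𝔤, ∀ v : 𝔤, bivectorAction 𝔤 T (δ₁ v) = δ₂ (autToEnd T v)

variable (𝔤) in
/-- The classes of equivalent (up to Lie algebra automorphisms) coboundary cocommutators. -/
def cocommutatorClasses : Set (Set (𝔤 →ₗ[ℝ] Bivector 𝔤)) :=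
  {C | ∃ δ, IsCoboundaryCocommutator δ ∧
    C = {δ' | IsCoboundaryCocommutator δ' ∧ CocommutatorEquiv δ δ'}}

variable (𝔤) in
/-- The orbits of `Aut(𝔤)` on the image of the set of solutions of the modified classical
Yang-Baxter equation in `Λ²𝔤 / (Λ²𝔤)^𝔤`. -/
def reducedOrbits : Set (Set (ReducedBivector 𝔤)) :=
  {O | ∃ p ∈ (invariantBivectors 𝔤).mkQ '' mCYBESolutions 𝔤,
    O = Set.range fun T : autGroup 𝔤 => reducedAction 𝔤 T p}

end Aut

/-! The geometric core is that the strata of both distributions are exactly the orbits of the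
identity component of `Aut(𝔤)`. Each distribution is spanned by linear vector fields `X`, the images
of derivations of `𝔤` under the differential of the representation. Give the vector space a finer
topology, in which the neighbourhoods of `x` are generated by the points `exp X x` with `X` a small
generator (`leafNhds`). A Grönwall estimate shows that the curve `exp (tX) x` cannot leave an
integral manifold through `x` for small `X`, so every integral manifold through `x` has this same
germ (`IsPlaque.map_nhds`).

Three facts follow. The orbits of the identity component are the connected components of the leaf
topology (`ExpAction.connectedComponent_toLeaf`). They carry charts, namely the local integral
manifolds parametrised by products of exponentials (`ExpAction.exists_isPlaque`), so they form an
integral stratification. The members of any integral stratification are open and connected in the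
leaf topology, and the complement of each is the union of the others; hence they are its components,
which gives uniqueness.

The input about the group is that automorphisms near the identity are exponentials of small
derivations (`eventually_mem_bilinDer_of_isBilinHom_exp`). It makes orbit maps continuous into the
leaf topology.

The algebraic core is `isRMatrix_iff_mem_mCYBESolutions`: twice the Jacobi sum of the dual bracket
of `δ_r`, evaluated at `v`, is the triple contraction of `[v, [r, r]]`, while the cocycle identity
holds for every `r`. With the orbit description this gives the first statement. For the second, `δ_r
= δ_s` exactly when `r - s` is invariant, and `r ↦ δ_r` is equivariant. For the third, sending `T`
to the stratum of `T p` is locally constant on the second countable group `Aut(𝔤)`, so it takes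
countably many values; the dimension is constant because the distribution is invariant. -/

/-! ### Plaques of a distribution spanned by linear vector fields -/

section Plaques

open Filter Topology

variable {V : Type*} [NormedAddCommGroup V] [NormedSpace ℝ V]
variable {K : Type*} [NormedAddCommGroup K] [NormedSpace ℝ K]

/-- The value at `x` of the distribution spanned by the linear vector fields `X ∈ 𝒳`. -/
noncomputable def evalDist (𝒳 : Submodule ℝ (V →L[ℝ] V)) (x : V) : Submodule ℝ V :=
  𝒳.map (ContinuousLinearMap.apply ℝ V x).toLinearMap

theorem mem_evalDist {𝒳 : Submodule ℝ (V →L[ℝ] V)} {x v : V} :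
    v ∈ evalDist 𝒳 x ↔ ∃ X ∈ 𝒳, X x = v := by
  simp [evalDist]

/-- `σ : W → V` parametrises an integral manifold of `evalDist 𝒳` that is a graph over `W` with
respect to the linear projection `L`. -/
structure IsPlaque (𝒳 : Submodule ℝ (V →L[ℝ] V)) (L : V →L[ℝ] K) (W : Set K) (σ : K → V) :
    Prop where
  isOpen : IsOpen W
  smooth : ContDiffOn ℝ ∞ σ W
  proj : ∀ w ∈ W, L (σ w) = w
  range_fderiv : ∀ w ∈ W, LinearMap.range (fderiv ℝ σ w).toLinearMap = evalDist 𝒳 (σ w)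

theorem continuous_exp_endomorphism [CompleteSpace V] :
    Continuous (NormedSpace.exp : (V →L[ℝ] V) → V →L[ℝ] V) :=
  continuous_iff_continuousAt.2 fun X => (NormedSpace.exp_analytic (𝕂 := ℝ) X).continuousAt

namespace IsPlaque

variable {𝒳 : Submodule ℝ (V →L[ℝ] V)} {L : V →L[ℝ] K} {W : Set K} {σ : K → V}

theorem hasFDerivAt (h : IsPlaque 𝒳 L W σ) {w : K} (hw : w ∈ W) :
    HasFDerivAt σ (fderiv ℝ σ w) w :=
  ((h.smooth.contDiffAt (h.isOpen.mem_nhds hw)).differentiableAt (by simp)).hasFDerivAt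

theorem proj_fderiv (h : IsPlaque 𝒳 L W σ) {w : K} (hw : w ∈ W) (u : K) :
    L (fderiv ℝ σ w u) = u := by
  have h1 : HasFDerivAt (fun w => L (σ w)) (L.comp (fderiv ℝ σ w)) w :=
    L.hasFDerivAt.comp w (h.hasFDerivAt hw)
  have h2 : HasFDerivAt (fun w => L (σ w)) (ContinuousLinearMap.id ℝ K) w := by
    refine (hasFDerivAt_id w).congr_of_eventuallyEq ?_
    filter_upwards [h.isOpen.mem_nhds hw] with v hv using h.proj v hv
  exact DFunLike.congr_fun (h1.unique h2) u

theorem fderiv_proj (h : IsPlaque 𝒳 L W σ) {w : K} (hw : w ∈ W) {v : V}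
    (hv : v ∈ evalDist 𝒳 (σ w)) : fderiv ℝ σ w (L v) = v := by
  rw [← h.range_fderiv w hw] at hv
  obtain ⟨u, rfl⟩ := hv
  exact congrArg _ (h.proj_fderiv hw u)

variable [CompleteSpace V]

/-- A curve `t ↦ exp (t X) (σ w₀)` whose projection stays where `σ` has bounded derivative stays in
the plaque. -/
theorem exp_apply_eq (h : IsPlaque 𝒳 L W σ) {w₀ : K} (hw₀ : w₀ ∈ W) {X : V →L[ℝ] V} (hX : X ∈ 𝒳)
    {C : ℝ} (hC : ∀ t ∈ Set.Icc (0 : ℝ) 1, L (NormedSpace.exp (t • X) (σ w₀)) ∈ W ∧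
      ‖fderiv ℝ σ (L (NormedSpace.exp (t • X) (σ w₀)))‖ ≤ C) :
    NormedSpace.exp X (σ w₀) = σ (L (NormedSpace.exp X (σ w₀))) := by
  set c : ℝ → V := fun t => NormedSpace.exp (t • X) (σ w₀) with hc
  have hc' : ∀ t, HasDerivAt c (X (c t)) t := fun t =>
    ((ContinuousLinearMap.apply ℝ V (σ w₀)).hasFDerivAt.comp_hasDerivAt t
      (hasDerivAt_exp_smul_const' X t))
  -- `e` measures the deviation of the curve from the plaque. Since `X` is tangent to the plaque at
  -- `σ (L (c t))`, the derivative of `e` depends linearly on `e`, and Grönwall with zero initial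
  -- value forces `e = 0`.
  set e : ℝ → V := fun t => c t - σ (L (c t)) with he
  have he' : ∀ t ∈ Set.Icc (0 : ℝ) 1,
      HasDerivAt e (X (e t) - fderiv ℝ σ (L (c t)) (L (X (e t)))) t := by
    intro t ht
    have h1 : HasDerivAt (fun t => L (c t)) (L (X (c t))) t :=
      L.hasFDerivAt.comp_hasDerivAt t (hc' t)
    have h2 : HasDerivAt (fun t => σ (L (c t))) (fderiv ℝ σ (L (c t)) (L (X (c t)))) t :=
      (h.hasFDerivAt (hC t ht).1).comp_hasDerivAt t h1
    have h3 : fderiv ℝ σ (L (c t)) (L (X (σ (L (c t))))) = X (σ (L (c t))) :=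
      h.fderiv_proj (hC t ht).1 (mem_evalDist.2 ⟨X, hX, rfl⟩)
    have h4 : X (e t) - fderiv ℝ σ (L (c t)) (L (X (e t))) =
        X (c t) - fderiv ℝ σ (L (c t)) (L (X (c t))) := by
      simp only [he, map_sub, h3]
      abel
    rw [h4]
    exact (hc' t).sub h2
  have h0 : e 0 = 0 := by simp [he, hc, h.proj _ hw₀]
  have hb := norm_le_gronwallBound_of_norm_deriv_right_le (δ := 0) (K := ‖X‖ + C * ‖L‖ * ‖X‖)
    (ε := 0) (f := e) (a := 0) (b := 1)
    (fun t ht => (he' t ht).continuousAt.continuousWithinAt)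
    (fun t ht => (he' t ⟨ht.1, ht.2.le⟩).hasDerivWithinAt) (by simp [h0]) (by
      intro t ht
      have hC0 := (norm_nonneg _).trans (hC t ⟨ht.1, ht.2.le⟩).2
      rw [add_zero, add_mul]
      refine (norm_sub_le _ _).trans (add_le_add (X.le_opNorm _) ?_)
      calc _ ≤ ‖fderiv ℝ σ (L (c t))‖ * (‖L‖ * (‖X‖ * ‖e t‖)) :=
            (ContinuousLinearMap.le_opNorm _ _).trans (by
              gcongr
              exact (L.le_opNorm _).trans (by gcongr; exact X.le_opNorm _))
        _ ≤ C * (‖L‖ * (‖X‖ * ‖e t‖)) := by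
              gcongr
              exact (hC t ⟨ht.1, ht.2.le⟩).2
        _ = _ := by ring) 1 (by simp)
  rw [gronwallBound_ε0, zero_mul, norm_le_zero_iff] at hb
  simpa [he, hc, sub_eq_zero] using hb

/-- A ball around `0` contains the whole segment `t • X` with each of its points `X`. So for small
`X` the entire curve projects to where `fderiv ℝ σ` is bounded, which is what `exp_apply_eq` needs.
-/
theorem eventually_exp_apply_eq (h : IsPlaque 𝒳 L W σ) {w₀ : K} (hw₀ : w₀ ∈ W) :
    ∀ᶠ X : 𝒳 in 𝓝 0, NormedSpace.exp (X : V →L[ℝ] V) (σ w₀) =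
      σ (L (NormedSpace.exp (X : V →L[ℝ] V) (σ w₀))) := by
  have hcont : ContinuousAt (fderiv ℝ σ) w₀ :=
    (h.smooth.contDiffAt (h.isOpen.mem_nhds hw₀)).continuousAt_fderiv (by simp)
  have h1 : ∀ᶠ w in 𝓝 w₀, w ∈ W ∧ ‖fderiv ℝ σ w‖ ≤ ‖fderiv ℝ σ w₀‖ + 1 :=
    (show ∀ᶠ w in 𝓝 w₀, w ∈ W from h.isOpen.mem_nhds hw₀).and
      ((hcont.norm.eventually (gt_mem_nhds (lt_add_one _))).mono fun _ h => h.le)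
  have h2 : Tendsto (fun X : 𝒳 => L (NormedSpace.exp (X : V →L[ℝ] V) (σ w₀))) (𝓝 0) (𝓝 w₀) := by
    have : Continuous (fun X : 𝒳 => L (NormedSpace.exp (X : V →L[ℝ] V) (σ w₀))) := by
      have hexp : Continuous (NormedSpace.exp : (V →L[ℝ] V) → _) :=
        continuous_exp_endomorphism
      fun_prop
    have h3 := this.tendsto 0
    simpa [h.proj _ hw₀] using h3
  obtain ⟨δ, hδ, hball⟩ := Metric.eventually_nhds_iff_ball.1 (h2.eventually h1)
  filter_upwards [Metric.ball_mem_nhds 0 hδ] with X hX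
  refine h.exp_apply_eq hw₀ X.2 (C := ‖fderiv ℝ σ w₀‖ + 1) fun t ht => ?_
  refine hball (t • X) ?_
  rw [mem_ball_zero_iff] at hX ⊢
  refine (norm_smul t (X : V →L[ℝ] V)).trans_lt ?_
  rw [Real.norm_of_nonneg ht.1]
  exact (mul_le_of_le_one_left (norm_nonneg _) ht.2).trans_lt hX

end IsPlaque

/-- The germ at `x` of the leaf through `x`. -/
noncomputable def leafNhds (𝒳 : Submodule ℝ (V →L[ℝ] V)) (x : V) : Filter V :=
  map (fun X : 𝒳 => NormedSpace.exp (X : V →L[ℝ] V) x) (𝓝 0)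

/-- The right-hand side does not involve the plaque, so all plaques through a point have the same
germ there. The map `X ↦ L (exp X x)` is a submersion at `0`, because the plaque is tangent to the
distribution, and for small `X` the point `exp X x` is the point of the plaque over its image. -/
theorem IsPlaque.map_nhds [FiniteDimensional ℝ V] [CompleteSpace K]
    {𝒳 : Submodule ℝ (V →L[ℝ] V)} {L : V →L[ℝ] K}
    {W : Set K} {σ : K → V} (h : IsPlaque 𝒳 L W σ) {w₀ : K} (hw₀ : w₀ ∈ W) :
    map σ (𝓝 w₀) = leafNhds 𝒳 (σ w₀) := by
  have : CompleteSpace V := FiniteDimensional.complete ℝ V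
  have : CompleteSpace 𝒳 := FiniteDimensional.complete ℝ 𝒳
  set g : 𝒳 → K := fun X => L (NormedSpace.exp (X : V →L[ℝ] V) (σ w₀)) with hg
  have hexp : HasStrictFDerivAt (fun X : 𝒳 => NormedSpace.exp (X : V →L[ℝ] V))
      𝒳.subtypeL (0 : 𝒳) := by
    have := (hasStrictFDerivAt_exp_zero (𝕂 := ℝ) (𝔸 := V →L[ℝ] V))
    have h0 : HasStrictFDerivAt (NormedSpace.exp : (V →L[ℝ] V) → _) 1 ((0 : 𝒳) : V →L[ℝ] V) := this
    exact h0.comp (0 : 𝒳) 𝒳.subtypeL.hasStrictFDerivAt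
  have hg' : HasStrictFDerivAt g
      ((L ∘L ContinuousLinearMap.apply ℝ V (σ w₀)) ∘L 𝒳.subtypeL) 0 :=
    (L ∘L ContinuousLinearMap.apply ℝ V (σ w₀)).hasStrictFDerivAt.comp (0 : 𝒳) hexp
  have hg0 : g 0 = w₀ := by simp [hg, h.proj _ hw₀]
  have hsurj : map g (𝓝 0) = 𝓝 w₀ := by
    rw [← hg0]
    refine HasStrictFDerivAt.map_nhds_eq_of_surj (E := 𝒳) (f := g)
      (f' := (L ∘L ContinuousLinearMap.apply ℝ V (σ w₀)) ∘L 𝒳.subtypeL) (a := (0 : 𝒳)) hg'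
      (LinearMap.range_eq_top.2 fun u => ?_)
    have hu : fderiv ℝ σ w₀ u ∈ evalDist 𝒳 (σ w₀) := by
      rw [← h.range_fderiv _ hw₀]; exact ⟨u, rfl⟩
    obtain ⟨X, hX, hXu⟩ := mem_evalDist.1 hu
    refine ⟨⟨X, hX⟩, ?_⟩
    change L (X (σ w₀)) = u
    rw [hXu, h.proj_fderiv hw₀]
  rw [← hsurj, map_map, leafNhds]
  exact map_congr ((h.eventually_exp_apply_eq hw₀).mono fun X hX => hX.symm)

/-- An immersion, followed by a suitable linear projection, is a local diffeomorphism. -/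
theorem exists_projection_of_immersion [FiniteDimensional ℝ V] [FiniteDimensional ℝ K]
    {ι : K → V} {T : Set K} (hT : IsOpen T) (hι : ContDiffOn ℝ ∞ ι T) {t₀ : K} (ht₀ : t₀ ∈ T)
    (hinj : Function.Injective (fderiv ℝ ι t₀)) :
    ∃ (L : V →L[ℝ] K) (φ : OpenPartialHomeomorph K K), (∀ t, φ t = L (ι t)) ∧ t₀ ∈ φ.source ∧
      φ.source ⊆ T ∧ ∀ w ∈ φ.target, ContDiffAt ℝ ∞ φ.symm w ∧
        ∃ e : K ≃L[ℝ] K, HasFDerivAt φ.symm (e : K →L[ℝ] K) w := by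
  have : CompleteSpace K := FiniteDimensional.complete ℝ K
  obtain ⟨L', hL'⟩ := LinearMap.exists_leftInverse_of_injective (fderiv ℝ ι t₀).toLinearMap
    (LinearMap.ker_eq_bot.2 hinj)
  set L : V →L[ℝ] K := LinearMap.toContinuousLinearMap L' with hL
  have hLι : ∀ u, L (fderiv ℝ ι t₀ u) = u := fun u => LinearMap.congr_fun hL' u
  have hιd : ∀ t ∈ T, HasFDerivAt (fun t => L (ι t)) (L ∘L fderiv ℝ ι t) t := fun t ht =>
    L.hasFDerivAt.comp t
      ((hι.contDiffAt (hT.mem_nhds ht)).differentiableAt (by simp)).hasFDerivAt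
  have hsm : ∀ t ∈ T, ContDiffAt ℝ ∞ (fun t => L (ι t)) t := fun t ht =>
    L.contDiff.contDiffAt.comp t (hι.contDiffAt (hT.mem_nhds ht))
  have hd0 : HasFDerivAt (fun t => L (ι t))
      ((ContinuousLinearEquiv.refl ℝ K : K ≃L[ℝ] K) : K →L[ℝ] K) t₀ := by
    convert hιd t₀ ht₀ using 1
    ext u
    exact (hLι u).symm
  have hstrict := (hsm t₀ ht₀).hasStrictFDerivAt' hd0 (by simp)
  -- Restricting to the points where the derivative of `L ∘ ι` is invertible makes the local inverse
  -- smooth on its whole domain, not only at the image of `t₀`.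
  set T' : Set K := {t ∈ T | fderiv ℝ (fun t => L (ι t)) t ∈
    Set.range (ContinuousLinearEquiv.toContinuousLinearMap : (K ≃L[ℝ] K) → _)} with hT'
  have hT'o : IsOpen T' := by
    refine ContinuousOn.isOpen_inter_preimage
      (fun t ht => ((hsm t ht).continuousAt_fderiv (by simp)).continuousWithinAt) hT
      (t := Set.range (ContinuousLinearEquiv.toContinuousLinearMap : (K ≃L[ℝ] K) → _))
      ContinuousLinearEquiv.isOpen
  have ht₀' : t₀ ∈ T' := ⟨ht₀, by rw [hd0.fderiv]; exact ⟨_, rfl⟩⟩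
  set φ := (hstrict.toOpenPartialHomeomorph (fun t => L (ι t))).restrOpen T' hT'o with hφ
  refine ⟨L, φ, fun t => rfl, ⟨hstrict.mem_toOpenPartialHomeomorph_source, ht₀'⟩,
    fun t ht => ht.2.1, fun w hw => ?_⟩
  obtain ⟨h1, e, he⟩ : φ.symm w ∈ T' := (φ.map_target hw).2
  have hd : HasFDerivAt φ (e : K →L[ℝ] K) (φ.symm w) := by
    rw [he, (hιd _ h1).fderiv]
    exact hιd _ h1
  exact ⟨φ.contDiffAt_symm hw hd (hsm _ h1), e.symm, φ.hasFDerivAt_symm hw hd⟩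

/-- An immersion tangent to the distribution is locally a plaque. -/
theorem exists_isPlaque_of_immersion [FiniteDimensional ℝ V] [FiniteDimensional ℝ K]
    {𝒳 : Submodule ℝ (V →L[ℝ] V)} {ι : K → V} {T : Set K} (hT : IsOpen T)
    (hι : ContDiffOn ℝ ∞ ι T) {t₀ : K} (ht₀ : t₀ ∈ T)
    (hinj : Function.Injective (fderiv ℝ ι t₀))
    (hrange : ∀ t ∈ T, LinearMap.range (fderiv ℝ ι t).toLinearMap = evalDist 𝒳 (ι t)) :
    ∃ (L : V →L[ℝ] K) (φ : OpenPartialHomeomorph K K), (∀ t, φ t = L (ι t)) ∧ t₀ ∈ φ.source ∧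
      φ.source ⊆ T ∧ IsPlaque 𝒳 L φ.target (fun w => ι (φ.symm w)) := by
  obtain ⟨L, φ, hφ, hs, hsT, hsymm⟩ := exists_projection_of_immersion hT hι ht₀ hinj
  have hmem : ∀ w ∈ φ.target, φ.symm w ∈ T := fun w hw => hsT (φ.map_target hw)
  refine ⟨L, φ, hφ, hs, hsT, φ.open_target, fun w hw => ?_, fun w hw => ?_, fun w hw => ?_⟩
  · exact ((hι.contDiffAt (hT.mem_nhds (hmem w hw))).comp w (hsymm w hw).1).contDiffWithinAt
  · rw [← hφ]
    exact φ.right_inv hw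
  · obtain ⟨-, e, he⟩ := hsymm w hw
    have h3 : HasFDerivAt (fun w => ι (φ.symm w))
        (fderiv ℝ ι (φ.symm w) ∘L (e : K →L[ℝ] K)) w :=
      ((hι.contDiffAt (hT.mem_nhds (hmem w hw))).differentiableAt
        (by simp)).hasFDerivAt.comp w he
    rw [h3.fderiv, ← hrange _ (hmem w hw)]
    exact LinearMap.range_comp_of_range_eq_top _ (LinearMap.range_eq_top.2 e.surjective)

end Plaques

/-! ### Linear group actions and their leaf topology -/

section LeafTopology

open Filter Topology

/-- A continuous linear action of a topological group `G` together with a space `gen` of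
infinitesimal generators, invariant under conjugation, which exponentiate to paths in `G` and whose
exponentials give all the operators of elements of `G` near `1`. -/
structure ExpAction (G V : Type*) [Group G] [TopologicalSpace G] [NormedAddCommGroup V]
    [NormedSpace ℝ V] where
  rep : G →* (V →L[ℝ] V)
  gen : Submodule ℝ (V →L[ℝ] V)
  conj_mem : ∀ (g : G) {X : V →L[ℝ] V}, X ∈ gen → rep g * X * rep g⁻¹ ∈ gen
  exists_path : ∀ X ∈ gen, ∃ γ : ℝ → G, Continuous γ ∧ γ 0 = 1 ∧
    ∀ t, rep (γ t) = NormedSpace.exp (t • X)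
  map_nhds_one_le : map rep (𝓝 1) ≤ map (fun X : gen => NormedSpace.exp (X : V →L[ℝ] V)) (𝓝 0)

namespace ExpAction

variable {G V : Type*} [Group G] [TopologicalSpace G] [NormedAddCommGroup V] [NormedSpace ℝ V]

/-- The vector space `V` with the leaf topology of an action. -/
structure Leaf (A : ExpAction G V) where
  /-- the underlying vector -/
  ofLeaf : V

variable (A : ExpAction G V)

theorem rep_mul_apply (g h : G) (x : V) : A.rep (g * h) x = A.rep g (A.rep h x) := by
  rw [map_mul]; rfl

theorem rep_inv_apply (g : G) (x : V) : A.rep g⁻¹ (A.rep g x) = x := by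
  rw [← rep_mul_apply, inv_mul_cancel, map_one]; rfl

/-- The generator `X` at `x` is carried to the conjugate generator `g X g⁻¹` at `g x`. -/
theorem map_evalDist_le (g : G) (x : V) :
    (evalDist A.gen x).map (A.rep g).toLinearMap ≤ evalDist A.gen (A.rep g x) := by
  rintro _ ⟨v, hv, rfl⟩
  obtain ⟨X, hX, rfl⟩ := mem_evalDist.1 hv
  refine mem_evalDist.2 ⟨_, A.conj_mem g hX, ?_⟩
  change A.rep g (X (A.rep g⁻¹ (A.rep g x))) = A.rep g (X x)
  rw [rep_inv_apply]

theorem apply_mem_evalDist (g : G) {x v : V} (hv : v ∈ evalDist A.gen x) :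
    A.rep g v ∈ evalDist A.gen (A.rep g x) :=
  A.map_evalDist_le g x ⟨v, hv, rfl⟩

section

variable [FiniteDimensional ℝ V]

/-- The inequality for `g` and for `g⁻¹` gives equality. The rank may jump from orbit to orbit but
is constant along each one. -/
theorem finrank_evalDist_rep (g : G) (x : V) :
    Module.finrank ℝ (evalDist A.gen (A.rep g x)) = Module.finrank ℝ (evalDist A.gen x) := by
  have key : ∀ (g : G) (x : V),
      Module.finrank ℝ (evalDist A.gen x) ≤ Module.finrank ℝ (evalDist A.gen (A.rep g x)) := by
    intro g x
    have hinj : Function.Injective (A.rep g).toLinearMap :=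
      Function.LeftInverse.injective (g := A.rep g⁻¹) (A.rep_inv_apply g)
    rw [(Submodule.equivMapOfInjective _ hinj (evalDist A.gen x)).finrank_eq]
    exact Submodule.finrank_mono (A.map_evalDist_le g x)
  refine le_antisymm ?_ (key g x)
  have h := key g⁻¹ (A.rep g x)
  rwa [rep_inv_apply] at h

/-- The parametrisation `t ↦ exp (t₁ X₁) ⋯ exp (tₖ Xₖ) x`. -/
theorem exists_parametrisation (x : V) {k : ℕ} (X : Fin k → V →L[ℝ] V) (hX : ∀ i, X i ∈ A.gen) :
    ∃ F : (Fin k → ℝ) → V, ContDiff ℝ ∞ F ∧ F 0 = x ∧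
      (∀ h, fderiv ℝ F 0 h = ∑ i, h i • X i x) ∧
      (∀ t h, fderiv ℝ F t h ∈ evalDist A.gen (F t)) ∧ ∀ t, ∃ g, F t = A.rep g x := by
  have : CompleteSpace V := FiniteDimensional.complete ℝ V
  induction k with
  | zero =>
    refine ⟨fun _ => x, contDiff_const, rfl, fun h => by simp, fun t h => by simp,
      fun t => ⟨1, by simp⟩⟩
  | succ k ih =>
    obtain ⟨F, hF, hF0, hF0', hF', hFg⟩ := ih (fun i => X i.succ) fun i => hX _
    obtain ⟨γ, -, -, hγ⟩ := A.exists_path (X 0) (hX 0)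
    set tail : (Fin (k + 1) → ℝ) →L[ℝ] (Fin k → ℝ) :=
      ContinuousLinearMap.pi fun i => ContinuousLinearMap.proj i.succ with htail
    set e : ℝ → V →L[ℝ] V := fun s => NormedSpace.exp (s • X 0) with he
    have hexp : ContDiff ℝ ∞ e := by
      have h1 : ContDiff ℝ ∞ (NormedSpace.exp : (V →L[ℝ] V) → V →L[ℝ] V) :=
        contDiff_iff_contDiffAt.2 fun X => (NormedSpace.exp_analytic (𝕂 := ℝ) X).contDiffAt
      exact h1.comp (by fun_prop)
    set Φ : (Fin (k + 1) → ℝ) → V := fun t => e (t 0) (F (tail t)) with hΦ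
    have hΦd : ∀ t, HasFDerivAt Φ
        ((e (t 0)).comp ((fderiv ℝ F (tail t)).comp tail) +
          ((((ContinuousLinearMap.toSpanSingleton ℝ (X 0 * e (t 0))).comp
            (ContinuousLinearMap.proj 0))).flip (F (tail t)))) t := by
      intro t
      have h1 : HasFDerivAt (fun t : Fin (k + 1) → ℝ => e (t 0))
          ((ContinuousLinearMap.toSpanSingleton ℝ (X 0 * e (t 0))).comp
            (ContinuousLinearMap.proj 0)) t :=
        HasFDerivAt.comp t (g := e) (hasDerivAt_exp_smul_const' (X 0) (t 0)).hasFDerivAt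
          (hasFDerivAt_apply (𝕜 := ℝ) (0 : Fin (k + 1)) t)
      have h2 : HasFDerivAt (fun t => F (tail t)) ((fderiv ℝ F (tail t)).comp tail) t :=
        (hF.differentiable (by simp) _).hasFDerivAt.comp t tail.hasFDerivAt
      exact h1.clm_apply h2
    have hΦd' : ∀ t h, fderiv ℝ Φ t h =
        e (t 0) (fderiv ℝ F (tail t) (tail h)) + h 0 • X 0 (Φ t) := by
      intro t h
      rw [(hΦd t).fderiv]
      rfl
    have he0 : e 0 = 1 := by simp [he]
    have hΦ0 : Φ 0 = x := by
      change e 0 (F (tail 0)) = x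
      rw [he0, map_zero, hF0]; rfl
    refine ⟨Φ, ?_, hΦ0, ?_, ?_, ?_⟩
    · exact (hexp.comp (contDiff_apply ℝ ℝ 0)).clm_apply (hF.comp tail.contDiff)
    · intro h
      rw [hΦd', hΦ0, Fin.sum_univ_succ, add_comm]
      congr 1
      change e 0 _ = _
      rw [he0, map_zero, hF0']
      rfl
    · intro t h
      rw [hΦd']
      refine add_mem ?_ (Submodule.smul_mem _ _ (mem_evalDist.2 ⟨X 0, hX 0, rfl⟩))
      -- The outer factor `exp (t₀ X₀)` is the operator of a group element, so it preserves the
      -- distribution.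
      have := A.apply_mem_evalDist (γ (t 0)) (hF' (tail t) (tail h))
      rwa [hγ] at this
    · intro t
      obtain ⟨g, hg⟩ := hFg (tail t)
      refine ⟨γ (t 0) * g, ?_⟩
      rw [rep_mul_apply, ← hg, hγ]

/-- Take generators whose values at `x` form a basis of the distribution there. The product of their
exponentials is an immersion near `0` with tangent spaces inside the distribution; constancy of the
rank along the orbit makes them equal to it. Invariance under the group replaces a Frobenius
argument. -/
theorem exists_isPlaque (x : V) :
    ∃ (L : V →L[ℝ] (Fin (Module.finrank ℝ (evalDist A.gen x)) → ℝ))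
      (W : Set (Fin (Module.finrank ℝ (evalDist A.gen x)) → ℝ))
      (σ : (Fin (Module.finrank ℝ (evalDist A.gen x)) → ℝ) → V),
      IsPlaque A.gen L W σ ∧ ∃ w ∈ W, σ w = x := by
  set k := Module.finrank ℝ (evalDist A.gen x) with hk
  let b := Module.finBasis ℝ (evalDist A.gen x)
  have hb : ∀ i, ∃ X ∈ A.gen, X x = b i := fun i => mem_evalDist.1 (b i).2
  choose X hX hXb using hb
  obtain ⟨F, hF, hF0, hF0', hF', hFg⟩ := A.exists_parametrisation x X hX
  have hinj : Function.Injective (fderiv ℝ F 0) := by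
    refine (injective_iff_map_eq_zero _).2 fun h hh => ?_
    rw [hF0'] at hh
    have h1 : ∑ i, h i • b i = 0 := by
      apply Subtype.ext
      simpa [hXb] using hh
    exact funext (Fintype.linearIndependent_iff.1 b.linearIndependent h h1)
  have hcont : Continuous (fderiv ℝ F) := hF.continuous_fderiv (by simp)
  have hT : IsOpen {t | Function.Injective (fderiv ℝ F t)} :=
    hcont.isOpen_preimage _ ContinuousLinearMap.isOpen_injective
  have hrange : ∀ t ∈ {t | Function.Injective (fderiv ℝ F t)},
      LinearMap.range (fderiv ℝ F t).toLinearMap = evalDist A.gen (F t) := by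
    intro t ht
    refine Submodule.eq_of_le_of_finrank_eq ?_ ?_
    · rintro _ ⟨h, rfl⟩
      exact hF' t h
    · obtain ⟨g, hg⟩ := hFg t
      rw [LinearMap.finrank_range_of_inj ht, hg, finrank_evalDist_rep]
      simp
  obtain ⟨L, φ, hφ, hs, -, hp⟩ := exists_isPlaque_of_immersion hT hF.contDiffOn hinj hinj hrange
  refine ⟨L, φ.target, _, hp, φ 0, φ.map_source hs, ?_⟩
  simp only [φ.left_inv hs, hF0]

theorem leafNhds_le (x : V) : leafNhds A.gen x ≤ 𝓝 x := by
  have : CompleteSpace V := FiniteDimensional.complete ℝ V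
  have h : Continuous (fun X : A.gen => NormedSpace.exp (X : V →L[ℝ] V) x) := by
    have := continuous_exp_endomorphism (V := V)
    fun_prop
  simpa [leafNhds, Tendsto] using h.tendsto 0

/-- This is `g exp(X) x = exp(g X g⁻¹) (g x)`, together with continuity of conjugation on the
generators. -/
theorem tendsto_rep_leafNhds (g : G) (x : V) :
    Tendsto (A.rep g) (leafNhds A.gen x) (leafNhds A.gen (A.rep g x)) := by
  have : CompleteSpace V := FiniteDimensional.complete ℝ V
  let +nondep : NormedAlgebra ℚ (V →L[ℝ] V) := .restrictScalars ℚ ℝ (V →L[ℝ] V)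
  let u : (V →L[ℝ] V)ˣ := ⟨A.rep g, A.rep g⁻¹, by rw [← map_mul]; simp, by rw [← map_mul]; simp⟩
  let c : A.gen → A.gen := fun X => ⟨A.rep g * X * A.rep g⁻¹, A.conj_mem g X.2⟩
  have hc : Tendsto c (𝓝 0) (𝓝 0) := by
    have : Continuous c :=
      Continuous.subtype_mk ((continuous_const.mul continuous_subtype_val).mul continuous_const) _
    convert this.tendsto 0
    apply Subtype.ext
    simp [c]
  rw [leafNhds, tendsto_map'_iff]
  have h : A.rep g ∘ (fun X : A.gen => NormedSpace.exp (X : V →L[ℝ] V) x) =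
      (fun X : A.gen => NormedSpace.exp (X : V →L[ℝ] V) (A.rep g x)) ∘ c := by
    funext X
    have h1 : NormedSpace.exp (A.rep g * (X : V →L[ℝ] V) * A.rep g⁻¹) =
        A.rep g * NormedSpace.exp (X : V →L[ℝ] V) * A.rep g⁻¹ := NormedSpace.exp_units_conj u X
    change _ = NormedSpace.exp (A.rep g * (X : V →L[ℝ] V) * A.rep g⁻¹) (A.rep g x)
    rw [h1]
    change _ = A.rep g (NormedSpace.exp (X : V →L[ℝ] V) (A.rep g⁻¹ (A.rep g x)))
    rw [rep_inv_apply]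
    rfl
  rw [h]
  exact tendsto_map.comp hc

end

/-! ### The leaf topology and its connected components -/

/-- A vector as a point of its leaf. -/
def toLeaf (x : V) : A.Leaf := ⟨x⟩

theorem toLeaf_ofLeaf (x : A.Leaf) : A.toLeaf x.ofLeaf = x := rfl

@[simp] theorem ofLeaf_toLeaf (x : V) : (A.toLeaf x).ofLeaf = x := rfl

noncomputable instance : TopologicalSpace A.Leaf :=
  TopologicalSpace.mkOfNhds fun x => map A.toLeaf (leafNhds A.gen x.ofLeaf)

/-- The substantial neighbourhood axiom is that a neighbourhood of `x` is one of all points near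
`x`. It holds because a plaque through `x` has the prescribed germ at each of its points. -/
theorem nhds_toLeaf [FiniteDimensional ℝ V] (x : V) :
    𝓝 (A.toLeaf x) = map A.toLeaf (leafNhds A.gen x) := by
  refine TopologicalSpace.nhds_mkOfNhds (fun x : A.Leaf => map A.toLeaf (leafNhds A.gen x.ofLeaf))
    _ (fun x => pure_le_iff.2 fun s hs => ?_) fun x s hs => ?_
  · have h : (fun X : A.gen => A.toLeaf (NormedSpace.exp (X : V →L[ℝ] V) x.ofLeaf)) ⁻¹' s ∈ 𝓝 0 :=
      hs
    simpa [toLeaf_ofLeaf] using mem_of_mem_nhds h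
  · obtain ⟨L, W, σ, h, w, hw, hx⟩ := A.exists_isPlaque x.ofLeaf
    have hσ : leafNhds A.gen x.ofLeaf = map σ (𝓝 w) := by rw [h.map_nhds hw, hx]
    simp only [hσ, map_map, mem_map, eventually_map] at hs ⊢
    filter_upwards [eventually_mem_nhds_iff.2 hs, h.isOpen.mem_nhds hw] with v hv hvW
    simp only [Function.comp_apply, ofLeaf_toLeaf, ← h.map_nhds hvW]
    exact hv

theorem continuous_ofLeaf [FiniteDimensional ℝ V] : Continuous (Leaf.ofLeaf : A.Leaf → V) :=
  continuous_iff_continuousAt.2 fun x => by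
    have h := A.nhds_toLeaf x.ofLeaf
    rw [toLeaf_ofLeaf] at h
    rw [ContinuousAt, h, tendsto_map'_iff]
    exact A.leafNhds_le x.ofLeaf

/-- Near `1`, operators are exponentials of small generators by `map_nhds_one_le`, which is
continuity at `1`. Writing `g = g₀ (g₀⁻¹ g)` moves it to `g₀`. -/
theorem continuous_orbitMap [FiniteDimensional ℝ V] [IsTopologicalGroup G] (x : V) :
    Continuous (fun g => A.toLeaf (A.rep g x)) := by
  refine continuous_iff_continuousAt.2 fun g₀ => ?_
  have h1 : Tendsto (fun g => A.rep g x) (𝓝 1) (leafNhds A.gen x) := by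
    have : map (fun T : V →L[ℝ] V => T x) (map A.rep (𝓝 1)) ≤ leafNhds A.gen x := by
      rw [leafNhds, ← Function.comp_def (fun T : V →L[ℝ] V => T x), ← map_map]
      exact map_mono A.map_nhds_one_le
    exact this
  have h2 : Tendsto (fun g => g₀⁻¹ * g) (𝓝 g₀) (𝓝 1) := by
    have : Continuous fun g => g₀⁻¹ * g := continuous_const.mul continuous_id
    simpa using this.tendsto g₀
  have h3 := (A.tendsto_rep_leafNhds g₀ x).comp (h1.comp h2)
  rw [ContinuousAt, nhds_toLeaf]
  refine tendsto_map.comp (h3.congr fun g => ?_)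
  change A.rep g₀ (A.rep (g₀⁻¹ * g) x) = _
  rw [← rep_mul_apply, mul_inv_cancel_left]

/-- The orbit of `x` under the identity component of `G`. -/
def orbit₀ (x : V) : Set V := (fun g => A.rep g x) '' connectedComponent 1

theorem mem_orbit₀_self (x : V) : x ∈ A.orbit₀ x :=
  ⟨1, mem_connectedComponent, by simp⟩

section

variable [IsTopologicalGroup G]

theorem mem_orbit₀_of_mem {x y z : V} (hy : y ∈ A.orbit₀ x) (hz : z ∈ A.orbit₀ y) :
    z ∈ A.orbit₀ x := by
  obtain ⟨g, hg, rfl⟩ := hy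
  obtain ⟨h, hh, rfl⟩ := hz
  exact ⟨h * g, (Subgroup.connectedComponentOfOne G).mul_mem hh hg, A.rep_mul_apply h g x⟩

theorem mem_orbit₀_symm {x y : V} (hy : y ∈ A.orbit₀ x) : x ∈ A.orbit₀ y := by
  obtain ⟨g, hg, rfl⟩ := hy
  exact ⟨g⁻¹, (Subgroup.connectedComponentOfOne G).inv_mem hg, A.rep_inv_apply g x⟩

/-- Each `exp X` is the operator of the endpoint of a path from `1`, so the neighbourhood `exp X y`
of a point `y` stays in the orbit. -/
theorem isOpen_orbit₀ [FiniteDimensional ℝ V] (x : V) : IsOpen (A.toLeaf '' A.orbit₀ x) := by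
  refine isOpen_iff_mem_nhds.2 ?_
  rintro _ ⟨y, hy, rfl⟩
  rw [nhds_toLeaf]
  refine image_mem_map (mem_map.2 (univ_mem' fun X => A.mem_orbit₀_of_mem hy ?_))
  obtain ⟨γ, hγ, hγ0, hγX⟩ := A.exists_path X X.2
  refine ⟨γ 1, ?_, ?_⟩
  · exact (isPreconnected_range hγ).subset_connectedComponent ⟨0, hγ0⟩ ⟨1, rfl⟩
  · change A.rep (γ 1) y = _
    rw [hγX, one_smul]

/-- The orbits are open and partition the space, hence are closed as well; each is connected as a
continuous image of the identity component. -/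
theorem connectedComponent_toLeaf [FiniteDimensional ℝ V] (x : V) :
    connectedComponent (A.toLeaf x) = A.toLeaf '' A.orbit₀ x := by
  have hx := Set.mem_image_of_mem A.toLeaf (A.mem_orbit₀_self x)
  refine Set.Subset.antisymm (IsClopen.connectedComponent_subset ⟨?_, A.isOpen_orbit₀ x⟩ hx) ?_
  · have h : (A.toLeaf '' A.orbit₀ x)ᶜ = ⋃ y ∈ (A.orbit₀ x)ᶜ, A.toLeaf '' A.orbit₀ y := by
      ext z
      simp only [Set.mem_iUnion, exists_prop, Set.mem_compl_iff]
      refine ⟨fun hz => ⟨z.ofLeaf, fun h => hz ⟨_, h, rfl⟩, _, A.mem_orbit₀_self _, rfl⟩, ?_⟩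
      rintro ⟨y, hy, z, hzy, rfl⟩ ⟨z', hz', h⟩
      obtain rfl : z' = z := congrArg Leaf.ofLeaf h
      exact hy (A.mem_orbit₀_of_mem hz' (A.mem_orbit₀_symm hzy))
    rw [← isOpen_compl_iff, h]
    exact isOpen_biUnion fun y _ => A.isOpen_orbit₀ y
  · have h := isPreconnected_connectedComponent.image _
      (A.continuous_orbitMap x).continuousOn (s := connectedComponent (1 : G))
    rw [orbit₀, Set.image_image]
    exact h.subset_connectedComponent ⟨1, mem_connectedComponent, by simp⟩

end

/-- A plaque as a chart of the leaf topology. -/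
noncomputable def plaqueChart [FiniteDimensional ℝ V] {K : Type*} [NormedAddCommGroup K]
    [NormedSpace ℝ K] [CompleteSpace K] {L : V →L[ℝ] K} {W : Set K} {σ : K → V}
    (h : IsPlaque A.gen L W σ) : OpenPartialHomeomorph A.Leaf K where
  toFun x := L x.ofLeaf
  invFun w := A.toLeaf (σ w)
  source := (fun w => A.toLeaf (σ w)) '' W
  target := W
  map_source' := by rintro _ ⟨w, hw, rfl⟩; rwa [ofLeaf_toLeaf, h.proj w hw]
  map_target' w hw := ⟨w, hw, rfl⟩
  left_inv' := by rintro _ ⟨w, hw, rfl⟩; rw [ofLeaf_toLeaf, h.proj w hw]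
  right_inv' w hw := h.proj w hw
  open_source := by
    refine isOpen_iff_mem_nhds.2 ?_
    rintro _ ⟨w, hw, rfl⟩
    rw [nhds_toLeaf, ← h.map_nhds hw, map_map]
    exact image_mem_map (h.isOpen.mem_nhds hw)
  open_target := h.isOpen
  continuousOn_toFun := (L.continuous.comp A.continuous_ofLeaf).continuousOn
  continuousOn_invFun w hw := by
    refine ContinuousAt.continuousWithinAt ?_
    rw [ContinuousAt, nhds_toLeaf, ← h.map_nhds hw, map_map]
    exact tendsto_map

end ExpAction

end LeafTopology

/-! ### Integral stratifications and the leaf topology -/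

section Strata

open Filter Topology

variable {G : Type*} [Group G] [TopologicalSpace G]
variable {E : Type*} [AddCommGroup E] [Module ℝ E] [FiniteDimensional ℝ E]

theorem ExpAction.exists_isPlaque_of_finrank_eq {V : Type*} [NormedAddCommGroup V]
    [NormedSpace ℝ V] [FiniteDimensional ℝ V] (A : ExpAction G V) (x : V) {k : ℕ}
    (hk : Module.finrank ℝ (evalDist A.gen x) = k) :
    ∃ (L : V →L[ℝ] (Fin k → ℝ)) (W : Set (Fin k → ℝ)) (σ : (Fin k → ℝ) → V),
      IsPlaque A.gen L W σ ∧ ∃ w ∈ W, σ w = x := by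
  subst hk
  exact A.exists_isPlaque x

/-- The tangent space of an immersed submanifold can be computed in any chart. -/
theorem ImmersedSubmanifold.range_fderiv_chart {S : Set E} (M : ImmersedSubmanifold S) (x y : S)
    (hy : letI := M.top; y ∈ (M.chart x).source) :
    letI := M.top
    LinearMap.range (fderiv ℝ (fun t => linCoords E ((M.chart x).symm t : E))
      (M.chart x y)).toLinearMap =
    LinearMap.range (fderiv ℝ (fun t => linCoords E ((M.chart y).symm t : E))
      (M.chart y y)).toLinearMap := by
  let := M.top
  set ex := M.chart x
  set ey := M.chart y
  set ιx : (Fin M.dim → ℝ) → _ := fun t => linCoords E (ex.symm t : E) with hιx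
  set ιy : (Fin M.dim → ℝ) → _ := fun t => linCoords E (ey.symm t : E) with hιy
  have hyy := M.mem_chart_source y
  have htx : ex y ∈ ex.target := ex.map_source hy
  have hty : ey y ∈ ey.target := ey.map_source hyy
  obtain ⟨L, φ, hφ, hs, -, hsymm⟩ := exists_projection_of_immersion ex.open_target (M.smooth x)
    htx (M.immersive x _ htx)
  set τ : (Fin M.dim → ℝ) → (Fin M.dim → ℝ) := fun t => ex (ey.symm t) with hτ
  have hey : ey.symm (ey y) = y := ey.left_inv hyy
  have h1 : Tendsto ey.symm (𝓝 (ey y)) (𝓝 y) := by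
    simpa [ContinuousAt, hey] using ey.symm.continuousAt (x := ey y) hty
  have h2 : Tendsto τ (𝓝 (ey y)) (𝓝 (ex y)) := (ex.continuousAt hy).tendsto.comp h1
  have hxd : HasFDerivAt ιx (fderiv ℝ ιx (ex y)) (ex y) :=
    (((M.smooth x).contDiffAt (ex.open_target.mem_nhds htx)).differentiableAt
      (by simp)).hasFDerivAt
  have hyd : HasFDerivAt ιy (fderiv ℝ ιy (ey y)) (ey y) :=
    (((M.smooth y).contDiffAt (ey.open_target.mem_nhds hty)).differentiableAt
      (by simp)).hasFDerivAt
  have hcomp : ∀ᶠ t in 𝓝 (ey y), ιx (τ t) = ιy t := by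
    filter_upwards [h1.eventually (ex.open_source.mem_nhds hy)] with t ht
    simp only [hιx, hιy, hτ, ex.left_inv ht]
  -- The transition map `τ` is so far only continuous. Writing it as `φ⁻¹ ∘ L ∘ ιy` shows that it is
  -- differentiable.
  have hτφ : ∀ᶠ t in 𝓝 (ey y), τ t = φ.symm (L (ιy t)) := by
    filter_upwards [hcomp, h2.eventually (φ.open_source.mem_nhds hs)] with t ht ht'
    rw [← ht, ← hφ, φ.left_inv ht']
  have hτy : τ (ey y) = ex y := by simp only [hτ, hey]
  have hval : L (ιy (ey y)) = φ (ex y) := by rw [hφ, ← hcomp.self_of_nhds, hτy]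
  obtain ⟨-, e, he⟩ := hsymm (φ (ex y)) (φ.map_source hs)
  rw [← hval] at he
  have hτd : HasFDerivAt τ ((e : _ →L[ℝ] _) ∘L (L ∘L fderiv ℝ ιy (ey y))) (ey y) :=
    (he.comp (ey y) (L.hasFDerivAt.comp (ey y) hyd)).congr_of_eventuallyEq hτφ
  have hcd : HasFDerivAt ιy
      (fderiv ℝ ιx (ex y) ∘L ((e : _ →L[ℝ] _) ∘L (L ∘L fderiv ℝ ιy (ey y)))) (ey y) := by
    rw [← hτy] at hxd
    have := (hxd.comp (ey y) hτd).congr_of_eventuallyEq (hcomp.mono fun t ht => ht.symm)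
    rwa [hτy] at this
  -- The chain rule gives one inclusion; both ranges have dimension `M.dim`.
  refine (Submodule.eq_of_le_of_finrank_eq ?_ ?_).symm
  · rw [hcd.fderiv]
    exact LinearMap.range_comp_le_range _ _
  · rw [LinearMap.finrank_range_of_inj (M.immersive x _ htx),
      LinearMap.finrank_range_of_inj (M.immersive y _ hty)]

variable (A : ExpAction G (Fin (Module.finrank ℝ E) → ℝ)) {D : E → Submodule ℝ E}

/-- The orbits of the identity component of `G`, read in `E`. -/
def ExpAction.stratum (x : E) : Set E := {y | linCoords E y ∈ A.orbit₀ (linCoords E x)}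

/-- An integral submanifold is embedded as an open subset in the leaf topology. -/
theorem ImmersedSubmanifold.isOpenEmbedding_toLeaf
    (hD : ∀ x, D x = (evalDist A.gen (linCoords E x)).comap (linCoords E).toLinearMap)
    {S : Set E} (M : ImmersedSubmanifold S) (hM : ∀ x : S, M.tangentSpace x = D x) :
    letI := M.top
    IsOpenEmbedding (fun s : S => A.toLeaf (linCoords E (s : E))) := by
  let := M.top
  have hinj : Function.Injective (fun s : S => A.toLeaf (linCoords E (s : E))) := fun a b h =>
    Subtype.ext ((linCoords E).injective (congrArg ExpAction.Leaf.ofLeaf h))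
  have hnhds : ∀ x : S, map (fun s : S => A.toLeaf (linCoords E (s : E))) (𝓝 x) =
      𝓝 (A.toLeaf (linCoords E (x : E))) := by
    intro x
    set ex := M.chart x with hex
    set ι : (Fin M.dim → ℝ) → _ := fun t => linCoords E (ex.symm t : E) with hι
    have hx := M.mem_chart_source x
    have htx : ex x ∈ ex.target := ex.map_source hx
    have hrange : ∀ t ∈ ex.target,
        LinearMap.range (fderiv ℝ ι t).toLinearMap = evalDist A.gen (ι t) := by
      intro t ht
      have h1 := M.range_fderiv_chart x (ex.symm t) (ex.map_target ht)
      have h2 := hM (ex.symm t)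
      rw [hD] at h2
      have h3 := Submodule.comap_injective_of_surjective
        (f := (linCoords E).toLinearMap) (linCoords E).surjective h2
      rw [← h3, ← h1, ex.right_inv ht]
    obtain ⟨L, φ, hφ, hs, hsT, hp⟩ := exists_isPlaque_of_immersion (𝒳 := A.gen) ex.open_target
      (M.smooth x) htx (M.immersive x _ htx) hrange
    -- Near `x` the submanifold is a plaque, so its own neighbourhoods are those of the leaf
    -- topology.
    have h4 : map (ι ∘ φ.symm) (𝓝 (φ (ex x))) = leafNhds A.gen (ι (φ.symm (φ (ex x)))) :=
      hp.map_nhds (φ.map_source hs)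
    have h5 : map φ.symm (𝓝 (φ (ex x))) = 𝓝 (ex x) := by
      rw [φ.symm.map_nhds_eq (φ.map_source hs), φ.left_inv hs]
    have h6 : map ex.symm (𝓝 (ex x)) = 𝓝 x := by
      rw [ex.symm.map_nhds_eq htx, ex.left_inv hx]
    have h7 : ι (φ.symm (φ (ex x))) = linCoords E x := by
      rw [φ.left_inv hs]; simp only [hι, ex.left_inv hx]
    rw [A.nhds_toLeaf]
    rw [h7, ← map_map, h5] at h4
    rw [← h4, ← h6, map_map, map_map]
    rfl
  refine IsOpenEmbedding.of_continuous_injective_isOpenMap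
    (continuous_iff_continuousAt.2 fun x => (hnhds x).le) hinj
    (IsOpenMap.of_nhds_le fun x => (hnhds x).ge)

theorem ExpAction.mem_stratum_self (x : E) : x ∈ A.stratum x := A.mem_orbit₀_self _

variable [IsTopologicalGroup G]

theorem ExpAction.toLeaf_image_stratum (x : E) :
    (fun y => A.toLeaf (linCoords E y)) '' A.stratum x =
      connectedComponent (A.toLeaf (linCoords E x)) := by
  rw [A.connectedComponent_toLeaf]
  ext y
  constructor
  · rintro ⟨z, hz, rfl⟩
    exact ⟨_, hz, rfl⟩
  · rintro ⟨z, hz, rfl⟩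
    exact ⟨(linCoords E).symm z, by simpa [ExpAction.stratum] using hz, by simp⟩

theorem ExpAction.stratum_eq_of_mem {x y : E} (h : y ∈ A.stratum x) :
    A.stratum y = A.stratum x := by
  ext z
  exact ⟨fun hz => A.mem_orbit₀_of_mem h hz,
    fun hz => A.mem_orbit₀_of_mem (A.mem_orbit₀_symm h) hz⟩

theorem ExpAction.isPartition_range_stratum :
    Setoid.IsPartition (Set.range (A.stratum : E → Set E)) := by
  refine ⟨?_, fun x => ⟨A.stratum x, ⟨⟨x, rfl⟩, A.mem_stratum_self x⟩, ?_⟩⟩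
  · rintro ⟨x, hx⟩
    exact (hx ▸ A.mem_stratum_self x : x ∈ (∅ : Set E))
  · rintro _ ⟨⟨y, rfl⟩, hy⟩
    exact (A.stratum_eq_of_mem hy).symm

/-- A stratification that integrates the distribution consists of orbits. -/
theorem ExpAction.eq_range_stratum_of_isIntegralStratification
    (hD : ∀ x, D x = (evalDist A.gen (linCoords E x)).comap (linCoords E).toLinearMap)
    {F : Set (Set E)} (hF : IsIntegralStratification D F) : F = Set.range A.stratum := by
  set f : E → A.Leaf := fun y => A.toLeaf (linCoords E y) with hf
  have hfinj : Function.Injective f := fun a b h =>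
    (linCoords E).injective (congrArg ExpAction.Leaf.ofLeaf h)
  have hopen : ∀ S ∈ F, IsOpen (f '' S) ∧ IsPreconnected (f '' S) := by
    intro S hS
    obtain ⟨k, M, -, hconn, hM⟩ := hF.2 S hS
    let := M.top
    have h := M.isOpenEmbedding_toLeaf A hD hM
    have himg : Set.range (fun s : S => A.toLeaf (linCoords E (s : E))) = f '' S := by
      rw [Set.image_eq_range]
    rw [← himg]
    exact ⟨h.isOpen_range, isPreconnected_range h.continuous⟩
  have key : ∀ S ∈ F, ∀ x ∈ S, S = A.stratum x := by
    intro S hS x hx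
    -- The complement of a member of the partition is the union of the other members, which are all
    -- open in the leaf topology. A nonempty connected clopen set is a component, that is, an orbit.
    have hclopen : IsClopen (f '' S) := by
      refine ⟨⟨?_⟩, (hopen S hS).1⟩
      have h : (f '' S)ᶜ = ⋃ S' ∈ F \ {S}, f '' S' := by
        ext z
        obtain ⟨y, rfl⟩ : ∃ y, f y = z :=
          ⟨(linCoords E).symm z.ofLeaf, by simp [hf, A.toLeaf_ofLeaf]⟩
        simp only [Set.mem_compl_iff, hfinj.mem_set_image, Set.mem_iUnion, exists_prop,
          Set.mem_sdiff, Set.mem_singleton_iff]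
        obtain ⟨S', ⟨hS', hyS'⟩, hu⟩ := hF.1.2 y
        constructor
        · intro hy
          exact ⟨S', ⟨hS', fun h => hy (h ▸ hyS')⟩, hyS'⟩
        · rintro ⟨S'', ⟨h1, h2⟩, h3⟩ hy
          exact h2 ((hu S'' ⟨h1, h3⟩).trans (hu S ⟨hS, hy⟩).symm)
      rw [h]
      exact isOpen_biUnion fun S' hS' => (hopen S' hS'.1).1
    have hxf : f x ∈ f '' S := ⟨x, hx, rfl⟩
    have h : f '' S = f '' A.stratum x := by
      rw [hf, A.toLeaf_image_stratum]
      exact Set.Subset.antisymm ((hopen S hS).2.subset_connectedComponent hxf)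
        (hclopen.connectedComponent_subset hxf)
    exact hfinj.image_injective h
  ext S
  constructor
  · intro hS
    obtain ⟨x, hx⟩ : S.Nonempty := Set.nonempty_iff_ne_empty.2 fun h => hF.1.1 (h ▸ hS)
    exact ⟨x, (key S hS x hx).symm⟩
  · rintro ⟨x, rfl⟩
    obtain ⟨S', ⟨hS', hx⟩, -⟩ := hF.1.2 x
    exact key S' hS' x hx ▸ hS'

variable [SecondCountableTopology G]

/-- The orbits of the identity component are connected integral submanifolds. -/
theorem ExpAction.isConnectedIntegralSubmanifold_stratum
    (hD : ∀ x, D x = (evalDist A.gen (linCoords E x)).comap (linCoords E).toLinearMap) (x : E) :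
    IsConnectedIntegralSubmanifold D
      (Module.finrank ℝ (evalDist A.gen (linCoords E x))) (A.stratum x) := by
  set k := Module.finrank ℝ (evalDist A.gen (linCoords E x)) with hk
  set S := A.stratum x with hS
  set f : S → A.Leaf := fun s => A.toLeaf (linCoords E (s : E)) with hf
  have hfinj : Function.Injective f := fun a b h =>
    Subtype.ext ((linCoords E).injective (congrArg ExpAction.Leaf.ofLeaf h))
  have hrange : Set.range f = A.toLeaf '' A.orbit₀ (linCoords E x) := by
    rw [← A.connectedComponent_toLeaf, ← A.toLeaf_image_stratum, Set.image_eq_range]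
  -- The manifold topology comes from the leaf topology, not from `E`; there the stratum is open and
  -- plaques give its charts.
  let top : TopologicalSpace S := TopologicalSpace.induced f inferInstance
  have hemb : IsOpenEmbedding f := ⟨⟨⟨rfl⟩, hfinj⟩, by rw [hrange]; exact A.isOpen_orbit₀ _⟩
  have hne : Nonempty S := ⟨⟨x, A.mem_stratum_self x⟩⟩
  have hfin : ∀ s : S, Module.finrank ℝ (evalDist A.gen (linCoords E (s : E))) = k := by
    rintro ⟨s, g, -, hg⟩
    simp only at hg ⊢
    rw [← hg, A.finrank_evalDist_rep]
  have hchart : ∀ s : S, ∃ e : OpenPartialHomeomorph S (Fin k → ℝ), s ∈ e.source ∧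
      ContDiffOn ℝ ∞ (fun t => linCoords E (e.symm t : E)) e.target ∧
      (∀ t ∈ e.target,
        Function.Injective (fderiv ℝ (fun t => linCoords E (e.symm t : E)) t)) ∧
      LinearMap.range (fderiv ℝ (fun t => linCoords E (e.symm t : E)) (e s)).toLinearMap =
        evalDist A.gen (linCoords E (s : E)) := by
    intro s
    obtain ⟨L, W, σ, h, w, hw, hws⟩ := A.exists_isPlaque_of_finrank_eq _ (hfin s)
    set e := (hemb.toOpenPartialHomeomorph f).trans (A.plaqueChart h) with he
    have hsource : s ∈ e.source := by
      refine ⟨trivial, ?_⟩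
      change f s ∈ (fun w => A.toLeaf (σ w)) '' W
      exact ⟨w, hw, congrArg A.toLeaf hws⟩
    have htarget : ∀ t ∈ e.target, t ∈ W := fun t ht => ht.1
    have hsymm : ∀ t ∈ e.target, linCoords E (e.symm t : E) = σ t := by
      intro t ht
      have h1 : f (e.symm t) = A.toLeaf (σ t) := by
        have h2 : (A.plaqueChart h).symm t ∈ (hemb.toOpenPartialHomeomorph f).target := ht.2
        exact (hemb.toOpenPartialHomeomorph f).right_inv h2
      exact congrArg ExpAction.Leaf.ofLeaf h1
    have hfd : ∀ t ∈ e.target,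
        fderiv ℝ (fun t => linCoords E (e.symm t : E)) t = fderiv ℝ σ t := by
      intro t ht
      refine Filter.EventuallyEq.fderiv_eq ?_
      filter_upwards [e.open_target.mem_nhds ht] with t ht using hsymm t ht
    refine ⟨e, hsource, (h.smooth.mono htarget).congr hsymm, fun t ht => ?_, ?_⟩
    · rw [hfd t ht]
      exact Function.LeftInverse.injective (g := L) (h.proj_fderiv (htarget t ht))
    · have ht := e.map_source hsource
      rw [hfd _ ht, h.range_fderiv _ (htarget _ ht), ← hsymm _ ht, e.left_inv hsource]
  choose chart hmem hsmooth himm htan using hchart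
  -- The stratum is a continuous image of a subset of a second countable group, so countably many
  -- chart domains cover it.
  have hlind : IsLindelof (Set.univ : Set S) := by
    rw [hemb.isInducing.isLindelof_iff, Set.image_univ, hrange, ExpAction.orbit₀, Set.image_image]
    exact (HereditarilyLindelofSpace.isLindelof _).image (A.continuous_orbitMap _)
  have hsc : SecondCountableTopology S := by
    obtain ⟨t, htc, -, ht⟩ := hlind.elim_nhds_subcover (fun s => (chart s).source)
      fun s _ => (chart s).open_source.mem_nhds (hmem s)
    have := htc.to_subtype
    have : ∀ i : t, SecondCountableTopology (chart i).source := fun i =>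
      (chart i).secondCountableTopology_source
    refine TopologicalSpace.secondCountableTopology_of_countable_cover
      (U := fun i : t => (chart i).source) (fun i => (chart i).open_source) ?_
    rw [← Set.univ_subset_iff]
    simpa [Set.iUnion_subtype] using ht
  have hconn : ConnectedSpace S := by
    have : IsPreconnected (Set.univ : Set S) := by
      rw [← hemb.isInducing.isPreconnected_image, Set.image_univ, hrange,
        ← A.connectedComponent_toLeaf]
      exact isPreconnected_connectedComponent
    exact { isPreconnected_univ := this, toNonempty := hne }
  refine ⟨⟨k, top, hsc, chart, hmem, hsmooth, himm⟩, rfl, hconn, fun s => ?_⟩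
  rw [hD, ← htan s]
  rfl

theorem ExpAction.isIntegralStratification_range_stratum
    (hD : ∀ x, D x = (evalDist A.gen (linCoords E x)).comap (linCoords E).toLinearMap) :
    IsIntegralStratification D (Set.range A.stratum) := by
  refine ⟨A.isPartition_range_stratum, ?_⟩
  rintro _ ⟨x, rfl⟩
  exact ⟨_, A.isConnectedIntegralSubmanifold_stratum hD x⟩

/-- The strata of the distribution are the orbits of the identity component. -/
theorem ExpAction.strata_eq
    (hD : ∀ x, D x = (evalDist A.gen (linCoords E x)).comap (linCoords E).toLinearMap) :
    strata D = Set.range A.stratum := by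
  ext S
  constructor
  · rintro ⟨F, hF, hS⟩
    rwa [← A.eq_range_stratum_of_isIntegralStratification hD hF]
  · intro hS
    exact ⟨_, A.isIntegralStratification_range_stratum hD, hS⟩

end Strata

/-! ### `r`-matrices and the modified classical Yang-Baxter equation -/

section RMatrix

variable {𝔤 : Type*} [LieRing 𝔤] [LieAlgebra ℝ 𝔤]

open CliffordAlgebra (contractLeft)

@[elab_as_elim]
theorem bivector_induction {p : ExteriorAlgebra ℝ 𝔤 → Prop}
    (mul : ∀ x y : 𝔤, p (ExteriorAlgebra.ι ℝ x * ExteriorAlgebra.ι ℝ y))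
    (add : ∀ P Q, p P → p Q → p (P + Q)) {P : ExteriorAlgebra ℝ 𝔤} (hP : P ∈ ⋀[ℝ]^2 𝔤) : p P := by
  rw [ExteriorAlgebra.exteriorPower, pow_two] at hP
  refine Submodule.mul_induction_on hP ?_ add
  rintro _ ⟨x, rfl⟩ _ ⟨y, rfl⟩
  exact mul x y

theorem ι_mul_ι_swap (x y : 𝔤) : ExteriorAlgebra.ι ℝ x * ExteriorAlgebra.ι ℝ y =
    -(ExteriorAlgebra.ι ℝ y * ExteriorAlgebra.ι ℝ x) :=
  eq_neg_of_add_eq_zero_left (ExteriorAlgebra.ι_add_mul_swap _ _)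

theorem contractLeft_mem (α : Module.Dual ℝ 𝔤) {n : ℕ} {Q : ExteriorAlgebra ℝ 𝔤}
    (hQ : Q ∈ ⋀[ℝ]^n 𝔤) : contractLeft α Q ∈ ⋀[ℝ]^(n - 1) 𝔤 := by
  induction hQ using Submodule.pow_induction_on_left' with
  | algebraMap c => rw [CliffordAlgebra.contractLeft_algebraMap]; exact zero_mem _
  | add x y i hx hy h₁ h₂ => rw [map_add]; exact add_mem h₁ h₂
  | mem_mul m hm i x hx h =>
    obtain ⟨u, rfl⟩ := hm
    change contractLeft α (CliffordAlgebra.ι 0 u * x) ∈ _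
    rw [CliffordAlgebra.contractLeft_ι_mul]
    refine sub_mem (Submodule.smul_mem _ _ hx) ?_
    -- Truncated subtraction makes degree `0` special: there `x` is a scalar and its contraction
    -- vanishes.
    rcases i with _ | i
    · rw [pow_zero] at hx
      obtain ⟨c, rfl⟩ := Submodule.mem_one.1 hx
      erw [CliffordAlgebra.contractLeft_algebraMap]
      rw [mul_zero]
      exact zero_mem _
    · change _ ∈ (LinearMap.range (ExteriorAlgebra.ι ℝ)) ^ (i + 1)
      rw [pow_succ']
      exact Submodule.mul_mem_mul ⟨u, rfl⟩ h

/-- This translates the pairing in `dualBracket` into contractions, with `α` contracted first. -/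
theorem contractLeft_pairingDual (α β : Module.Dual ℝ 𝔤) (P : Bivector 𝔤) :
    contractLeft β (contractLeft α (P : ExteriorAlgebra ℝ 𝔤)) = algebraMap ℝ _
      (exteriorPower.pairingDual ℝ 𝔤 2 (exteriorPower.ιMulti ℝ 2 ![α, β]) P) := by
  have h : contractLeft β ∘ₗ contractLeft α ∘ₗ (⋀[ℝ]^2 𝔤).subtype =
      Algebra.linearMap ℝ (ExteriorAlgebra ℝ 𝔤) ∘ₗ
        exteriorPower.pairingDual ℝ 𝔤 2 (exteriorPower.ιMulti ℝ 2 ![α, β]) := by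
    ext m
    simp only [LinearMap.compAlternatingMap_apply, LinearMap.comp_apply, Submodule.subtype_apply,
      exteriorPower.ιMulti_apply_coe, ExteriorAlgebra.ιMulti_apply,
      exteriorPower.pairingDual_ιMulti_ιMulti, Matrix.det_fin_two]
    simp only [List.ofFn_succ, List.ofFn_zero, List.prod_cons, List.prod_nil, mul_one]
    erw [CliffordAlgebra.contractLeft_ι_mul]
    rw [map_sub, map_smul, CliffordAlgebra.contractLeft_ι]
    erw [CliffordAlgebra.contractLeft_ι, CliffordAlgebra.contractLeft_ι_mul]
    simp [Algebra.smul_def, CliffordAlgebra.contractLeft_algebraMap]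
  exact LinearMap.congr_fun h P

variable [FiniteDimensional ℝ 𝔤]

/-- Euler's identity in the Grassmann algebra. -/
theorem sum_ι_mul_contractLeft {n : ℕ} {Q : ExteriorAlgebra ℝ 𝔤} (hQ : Q ∈ ⋀[ℝ]^n 𝔤) :
    ∑ a, ExteriorAlgebra.ι ℝ (Module.finBasis ℝ 𝔤 a) *
      contractLeft ((Module.finBasis ℝ 𝔤).coord a) Q = (n : ℝ) • Q := by
  induction hQ using Submodule.pow_induction_on_left' with
  | algebraMap c => simp [CliffordAlgebra.contractLeft_algebraMap]
  | add x y i hx hy h₁ h₂ => simp only [map_add, mul_add, Finset.sum_add_distrib, h₁, h₂, smul_add]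
  | mem_mul m hm i x hx h =>
    obtain ⟨u, rfl⟩ := hm
    have hu : ExteriorAlgebra.ι ℝ u = ∑ a, (Module.finBasis ℝ 𝔤).coord a u •
        ExteriorAlgebra.ι ℝ (Module.finBasis ℝ 𝔤 a) := by
      conv_lhs => rw [← (Module.finBasis ℝ 𝔤).sum_repr u]
      simp only [map_sum, map_smul, Module.Basis.coord_apply]
    have h1 : ∀ a, ExteriorAlgebra.ι ℝ (Module.finBasis ℝ 𝔤 a) *
        contractLeft ((Module.finBasis ℝ 𝔤).coord a) (ExteriorAlgebra.ι ℝ u * x) =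
        ((Module.finBasis ℝ 𝔤).coord a u • ExteriorAlgebra.ι ℝ (Module.finBasis ℝ 𝔤 a)) * x +
          ExteriorAlgebra.ι ℝ u * (ExteriorAlgebra.ι ℝ (Module.finBasis ℝ 𝔤 a) *
            contractLeft ((Module.finBasis ℝ 𝔤).coord a) x) := by
      intro a
      rw [CliffordAlgebra.contractLeft_ι_mul, mul_sub, ← mul_assoc, ← mul_assoc]
      rw [ι_mul_ι_swap u]
      simp [sub_eq_add_neg]
    simp only [h1, Finset.sum_add_distrib, ← Finset.sum_mul, ← Finset.mul_sum, h, ← hu]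
    push_cast
    rw [mul_smul_comm, add_smul, one_smul, add_comm]

/-- Euler's identity recovers `(n + 1) Q` from the contractions of `Q`. Positive degree is
essential, since scalars have zero contractions. -/
theorem eq_zero_of_contractLeft {n : ℕ} {Q : ExteriorAlgebra ℝ 𝔤} (hQ : Q ∈ ⋀[ℝ]^(n + 1) 𝔤)
    (h : ∀ α : Module.Dual ℝ 𝔤, contractLeft α Q = 0) : Q = 0 := by
  have h1 := sum_ι_mul_contractLeft hQ
  simp only [h, mul_zero, Finset.sum_const_zero] at h1
  exact (smul_eq_zero.1 h1.symm).resolve_left (by positivity)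

/-- Bracketing with a decomposable bivector is thereby expressed through the derivations `[x, ·]`
and `[y, ·]`, to which most later bivector identities reduce. -/
theorem schouten_ι_mul_ι_left (x y : 𝔤) (Q : ExteriorAlgebra ℝ 𝔤) :
    schouten (ExteriorAlgebra.ι ℝ x * ExteriorAlgebra.ι ℝ y) Q =
      ExteriorAlgebra.ι ℝ x * schouten (ExteriorAlgebra.ι ℝ y) Q -
        ExteriorAlgebra.ι ℝ y * schouten (ExteriorAlgebra.ι ℝ x) Q := by
  have hv : ∀ (v : 𝔤) (b), ⁅v, Module.finBasis ℝ 𝔤 b⁆ = ∑ a, (Module.finBasis ℝ 𝔤).coord a v •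
      ⁅Module.finBasis ℝ 𝔤 a, Module.finBasis ℝ 𝔤 b⁆ := by
    intro v b
    conv_lhs => rw [← (Module.finBasis ℝ 𝔤).sum_repr v]
    simp only [sum_lie, smul_lie, Module.Basis.coord_apply]
  rw [schouten_apply, schouten_ι_apply, schouten_ι_apply, Finset.sum_comm, Finset.mul_sum,
    Finset.mul_sum, ← Finset.sum_sub_distrib]
  refine Finset.sum_congr rfl fun b _ => ?_
  have hc : ∀ a, contractLeft ((Module.finBasis ℝ 𝔤).coord a)
      (ExteriorAlgebra.ι ℝ x * ExteriorAlgebra.ι ℝ y) =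
        (Module.finBasis ℝ 𝔤).coord a x • ExteriorAlgebra.ι ℝ y -
          (Module.finBasis ℝ 𝔤).coord a y • ExteriorAlgebra.ι ℝ x := fun a => by
    rw [CliffordAlgebra.contractLeft_ι_mul, CliffordAlgebra.contractLeft_ι, ← Algebra.commutes,
      ← Algebra.smul_def]
  have h1 : ∑ a, ExteriorAlgebra.ι ℝ ⁅Module.finBasis ℝ 𝔤 a, Module.finBasis ℝ 𝔤 b⁆ *
      contractLeft ((Module.finBasis ℝ 𝔤).coord a)
        (ExteriorAlgebra.ι ℝ x * ExteriorAlgebra.ι ℝ y) =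
      ExteriorAlgebra.ι ℝ ⁅x, Module.finBasis ℝ 𝔤 b⁆ * ExteriorAlgebra.ι ℝ y -
        ExteriorAlgebra.ι ℝ ⁅y, Module.finBasis ℝ 𝔤 b⁆ * ExteriorAlgebra.ι ℝ x := by
    rw [hv x, hv y]
    simp only [hc, map_sum, map_smul, Finset.sum_mul, mul_sub, mul_smul_comm, smul_mul_assoc,
      Finset.sum_sub_distrib]
  rw [← Finset.sum_mul, h1, ← mul_assoc, ← mul_assoc, ← sub_mul, ι_mul_ι_swap x, ι_mul_ι_swap y,
    sub_neg_eq_add, neg_add_eq_sub]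

theorem schouten_ι_right (v : 𝔤) (P : ExteriorAlgebra ℝ 𝔤) :
    schouten P (ExteriorAlgebra.ι ℝ v) = -schouten (ExteriorAlgebra.ι ℝ v) P := by
  have hv : ∀ a, ⁅Module.finBasis ℝ 𝔤 a, v⁆ = ∑ b, (Module.finBasis ℝ 𝔤).coord b v •
      ⁅Module.finBasis ℝ 𝔤 a, Module.finBasis ℝ 𝔤 b⁆ := by
    intro a
    conv_lhs => rw [← (Module.finBasis ℝ 𝔤).sum_repr v]
    simp only [lie_sum, lie_smul, Module.Basis.coord_apply]
  rw [schouten_apply, schouten_ι_apply, ← Finset.sum_neg_distrib]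
  refine Finset.sum_congr rfl fun a _ => ?_
  rw [← neg_mul, ← map_neg, lie_skew, hv, map_sum, Finset.sum_mul]
  refine Finset.sum_congr rfl fun b _ => ?_
  rw [CliffordAlgebra.contractLeft_ι, ← Algebra.commutes, ← Algebra.smul_def, map_smul,
    smul_mul_assoc]

/-- The Jacobi identity on vectors, extended by the derivation rule. Read for `P = r`, it is the
cocycle identity of `δ_r`. -/
theorem schouten_ι_lie (v w : 𝔤) {P : ExteriorAlgebra ℝ 𝔤} (hP : P ∈ ⋀[ℝ]^2 𝔤) :
    schouten (ExteriorAlgebra.ι ℝ ⁅v, w⁆) P =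
      schouten (ExteriorAlgebra.ι ℝ v) (schouten (ExteriorAlgebra.ι ℝ w) P) -
        schouten (ExteriorAlgebra.ι ℝ w) (schouten (ExteriorAlgebra.ι ℝ v) P) := by
  have hι : ∀ v x : 𝔤, schouten (ExteriorAlgebra.ι ℝ v) (ExteriorAlgebra.ι ℝ x) =
      ExteriorAlgebra.ι ℝ ⁅v, x⁆ := fun v x => by
    have := schouten_ι_ι_mul v x 1
    rwa [← map_one (algebraMap ℝ (ExteriorAlgebra ℝ 𝔤)), schouten_ι_algebraMap, mul_zero, add_zero,
      map_one, mul_one, mul_one] at this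
  refine bivector_induction (p := fun P => schouten (ExteriorAlgebra.ι ℝ ⁅v, w⁆) P =
      schouten (ExteriorAlgebra.ι ℝ v) (schouten (ExteriorAlgebra.ι ℝ w) P) -
        schouten (ExteriorAlgebra.ι ℝ w) (schouten (ExteriorAlgebra.ι ℝ v) P)) ?_ ?_ hP
  · intro x y
    simp only [schouten_ι_ι_mul, map_add, hι, lie_lie, map_sub, sub_mul, mul_sub]
    abel
  · intro P Q hP hQ
    simp only [map_add, hP, hQ]
    abel

/-- In degree two the bracket is symmetric, which is why `[v, [r, r]] = 2 [[v, r], r]`. -/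
theorem schouten_comm_of_bivector {P Q : ExteriorAlgebra ℝ 𝔤} (hP : P ∈ ⋀[ℝ]^2 𝔤)
    (hQ : Q ∈ ⋀[ℝ]^2 𝔤) : schouten P Q = schouten Q P := by
  refine bivector_induction (p := fun P => schouten P Q = schouten Q P) (fun x₁ x₂ => ?_) ?_ hP
  · refine bivector_induction (p := fun Q => schouten (ExteriorAlgebra.ι ℝ x₁ *
      ExteriorAlgebra.ι ℝ x₂) Q = schouten Q (ExteriorAlgebra.ι ℝ x₁ * ExteriorAlgebra.ι ℝ x₂))
      (fun y₁ y₂ => ?_) ?_ hQ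
    · have hs : ∀ a x y : 𝔤, ExteriorAlgebra.ι ℝ a * ExteriorAlgebra.ι ℝ x * ExteriorAlgebra.ι ℝ y =
          -(ExteriorAlgebra.ι ℝ a * ExteriorAlgebra.ι ℝ y * ExteriorAlgebra.ι ℝ x) :=
        fun a x y => by rw [mul_assoc, ι_mul_ι_swap x, mul_neg, mul_assoc]
      rw [schouten_ι_mul_ι, schouten_ι_mul_ι, ← lie_skew x₁ y₁, ← lie_skew x₁ y₂, ← lie_skew x₂ y₁,
        ← lie_skew x₂ y₂, hs _ y₂ x₂, hs _ y₂ x₁, hs _ y₁ x₁, hs _ y₁ x₂]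
      simp only [map_neg, neg_mul]
      abel
    · intro P Q hP hQ
      simp only [map_add, LinearMap.add_apply, hP, hQ]
  · intro P Q hP hQ
    simp only [map_add, LinearMap.add_apply, hP, hQ]

/-- The Schouten bracket of bivectors is `𝔤`-equivariant. -/
theorem schouten_ι_schouten (v : 𝔤) {P Q : ExteriorAlgebra ℝ 𝔤} (hP : P ∈ ⋀[ℝ]^2 𝔤)
    (hQ : Q ∈ ⋀[ℝ]^2 𝔤) : schouten (ExteriorAlgebra.ι ℝ v) (schouten P Q) =
      schouten (schouten (ExteriorAlgebra.ι ℝ v) P) Q +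
        schouten P (schouten (ExteriorAlgebra.ι ℝ v) Q) := by
  have hι : ∀ v x : 𝔤, schouten (ExteriorAlgebra.ι ℝ v) (ExteriorAlgebra.ι ℝ x) =
      ExteriorAlgebra.ι ℝ ⁅v, x⁆ := fun v x => by
    have := schouten_ι_ι_mul v x 1
    rwa [← map_one (algebraMap ℝ (ExteriorAlgebra ℝ 𝔤)), schouten_ι_algebraMap, mul_zero, add_zero,
      map_one, mul_one, mul_one] at this
  refine bivector_induction (p := fun P => schouten (ExteriorAlgebra.ι ℝ v) (schouten P Q) =
      schouten (schouten (ExteriorAlgebra.ι ℝ v) P) Q +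
        schouten P (schouten (ExteriorAlgebra.ι ℝ v) Q)) (fun x y => ?_) ?_ hP
  · have h1 := fun w => schouten_ι_lie v w hQ
    simp only [schouten_ι_mul_ι_left, schouten_ι_ι_mul, hι, map_sub, map_add, LinearMap.add_apply,
      h1, mul_sub]
    abel
  · intro P P' hP hP'
    simp only [map_add, LinearMap.add_apply, hP, hP']
    abel

theorem schouten_mem {P Q : ExteriorAlgebra ℝ 𝔤} (hP : P ∈ ⋀[ℝ]^2 𝔤) (hQ : Q ∈ ⋀[ℝ]^2 𝔤) :
    schouten P Q ∈ ⋀[ℝ]^3 𝔤 := by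
  refine bivector_induction (p := fun P => schouten P Q ∈ ⋀[ℝ]^3 𝔤) (fun x y => ?_) ?_ hP
  · have h : ∀ x y : 𝔤, ExteriorAlgebra.ι ℝ x * schouten (ExteriorAlgebra.ι ℝ y) Q ∈ ⋀[ℝ]^3 𝔤 := by
      intro x y
      rw [ExteriorAlgebra.exteriorPower, pow_succ']
      exact Submodule.mul_mem_mul ⟨x, rfl⟩ (schouten_ι_mem y hQ)
    rw [schouten_ι_mul_ι_left]
    exact sub_mem (h x y) (h y x)
  · intro P P' hP hP'
    rw [map_add, LinearMap.add_apply]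
    exact add_mem hP hP'

/-! ### The dual bracket of a coboundary and the Jacobi identity -/

theorem coe_coboundary (r : Bivector 𝔤) (v : 𝔤) :
    (coboundary r v : ExteriorAlgebra ℝ 𝔤) = schouten (ExteriorAlgebra.ι ℝ v) r := rfl

theorem contractLeft_coboundary (r : Bivector 𝔤) (α β : Module.Dual ℝ 𝔤) (v : 𝔤) :
    contractLeft β (contractLeft α (schouten (ExteriorAlgebra.ι ℝ v) (r : ExteriorAlgebra ℝ 𝔤))) =
      algebraMap ℝ (ExteriorAlgebra ℝ 𝔤) (dualBracket (coboundary r) α β v) :=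
  contractLeft_pairingDual α β (coboundary r v)

/-- For `P = x ∧ y` the bracket is `x ∧ δ_r y - y ∧ δ_r x`; three contractions leave one covector on
a vector and a dual bracket on the other, summed cyclically. Taking `P = δ_r v` turns this into the
Jacobi sum. -/
theorem contractLeft_schouten (r : Bivector 𝔤) (α β γ : Module.Dual ℝ 𝔤) (P : Bivector 𝔤) :
    contractLeft γ (contractLeft β (contractLeft α (schouten (P : ExteriorAlgebra ℝ 𝔤) r))) =
      contractLeft (dualBracket (coboundary r) β γ) (contractLeft α (P : ExteriorAlgebra ℝ 𝔤)) +
      contractLeft (dualBracket (coboundary r) γ α) (contractLeft β (P : ExteriorAlgebra ℝ 𝔤)) +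
      contractLeft (dualBracket (coboundary r) α β) (contractLeft γ (P : ExteriorAlgebra ℝ 𝔤)) := by
  refine bivector_induction (p := fun P => contractLeft γ (contractLeft β (contractLeft α
      (schouten P (r : ExteriorAlgebra ℝ 𝔤)))) =
      contractLeft (dualBracket (coboundary r) β γ) (contractLeft α P) +
      contractLeft (dualBracket (coboundary r) γ α) (contractLeft β P) +
      contractLeft (dualBracket (coboundary r) α β) (contractLeft γ P)) (fun x y => ?_) ?_ P.2
  · have hsw : ∀ v, contractLeft γ (contractLeft α (schouten (ExteriorAlgebra.ι ℝ v)
        (r : ExteriorAlgebra ℝ 𝔤))) = -contractLeft α (contractLeft γ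
          (schouten (ExteriorAlgebra.ι ℝ v) (r : ExteriorAlgebra ℝ 𝔤))) := fun v =>
      CliffordAlgebra.contractLeft_comm _ _ _
    have hm : ∀ (δ : Module.Dual ℝ 𝔤) (u : 𝔤) (b : ExteriorAlgebra ℝ 𝔤),
        contractLeft δ (ExteriorAlgebra.ι ℝ u * b) =
          δ u • b - ExteriorAlgebra.ι ℝ u * contractLeft δ b := fun δ u b =>
      CliffordAlgebra.contractLeft_ι_mul _ _ _
    have hι : ∀ (δ : Module.Dual ℝ 𝔤) (u : 𝔤), contractLeft δ (ExteriorAlgebra.ι ℝ u) =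
        algebraMap ℝ (ExteriorAlgebra ℝ 𝔤) (δ u) := fun δ u => CliffordAlgebra.contractLeft_ι _ _ _
    have hc : ∀ (δ : Module.Dual ℝ 𝔤) (c : ℝ),
        contractLeft δ (algebraMap ℝ (ExteriorAlgebra ℝ 𝔤) c) = 0 := fun δ c =>
      CliffordAlgebra.contractLeft_algebraMap _ _ _
    rw [schouten_ι_mul_ι_left]
    simp only [map_sub, hm, map_smul, hsw, hι, hc, mul_zero, sub_zero, contractLeft_coboundary]
    simp only [Algebra.algebraMap_eq_smul_one]
    module
  · intro P P' hP hP'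
    simp only [map_add, LinearMap.add_apply, hP, hP']
    abel

/-- `r` is an `r`-matrix if and only if it solves the modified classical Yang-Baxter equation. -/
theorem isRMatrix_iff_mem_mCYBESolutions (r : Bivector 𝔤) :
    IsRMatrix r ↔ r ∈ mCYBESolutions 𝔤 := by
  have hJ : ∀ (α β γ : Module.Dual ℝ 𝔤) (v : 𝔤),
      algebraMap ℝ (ExteriorAlgebra ℝ 𝔤) (2 * (dualBracket (coboundary r) α
        (dualBracket (coboundary r) β γ) + dualBracket (coboundary r) β
          (dualBracket (coboundary r) γ α) + dualBracket (coboundary r) γ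
            (dualBracket (coboundary r) α β)) v) =
      contractLeft γ (contractLeft β (contractLeft α (schouten (ExteriorAlgebra.ι ℝ v)
        (schouten (r : ExteriorAlgebra ℝ 𝔤) r)))) := by
    intro α β γ v
    rw [schouten_ι_schouten v r.2 r.2, schouten_comm_of_bivector r.2 (schouten_ι_mem v r.2),
      map_add, map_add, map_add, ← coe_coboundary, contractLeft_schouten, coe_coboundary,
      contractLeft_coboundary, contractLeft_coboundary, contractLeft_coboundary, ← map_add,
      ← map_add, ← map_add, two_mul]
    rfl
  have hinj := (algebraMap ℝ (ExteriorAlgebra ℝ 𝔤)).injective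
  constructor
  · intro h
    refine ⟨schouten_mem r.2 r.2, fun v => ?_⟩
    have hmem := schouten_ι_mem v (schouten_mem r.2 r.2)
    -- A trivector vanishes once all its triple contractions do, by descending through degrees
    -- three, two and one.
    refine eq_zero_of_contractLeft hmem fun α => ?_
    refine eq_zero_of_contractLeft (contractLeft_mem α hmem) fun β => ?_
    refine eq_zero_of_contractLeft (contractLeft_mem β (contractLeft_mem α hmem)) fun γ => ?_
    rw [← hJ, h.jacobi α β γ, LinearMap.zero_apply, mul_zero, map_zero]
  · rintro ⟨-, h⟩
    refine ⟨fun α β γ => LinearMap.ext fun v => ?_, fun v₁ v₂ => ?_⟩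
    · have h1 := hJ α β γ v
      rw [h v, map_zero, map_zero, map_zero] at h1
      have h2 := (map_eq_zero_iff _ hinj).1 h1
      rw [LinearMap.zero_apply]
      linarith
    · rw [schouten_ι_right]
      simp only [coe_coboundary]
      rw [schouten_ι_lie _ _ r.2, sub_eq_add_neg]

end RMatrix

/-! ### Automorphisms and derivations of a bilinear operation -/

section BilinearAut

open Filter Topology

variable {U : Type*} [NormedAddCommGroup U] [NormedSpace ℝ U]

theorem exp_neg_mul_exp [CompleteSpace U] (D : U →L[ℝ] U) :
    NormedSpace.exp (-D) * NormedSpace.exp D = 1 := by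
  let +nondep : NormedAlgebra ℚ (U →L[ℝ] U) := .restrictScalars ℚ ℝ (U →L[ℝ] U)
  rw [← NormedSpace.exp_add_of_commute ((Commute.refl D).neg_left), neg_add_cancel,
    NormedSpace.exp_zero]

theorem exp_mul_exp_neg [CompleteSpace U] (D : U →L[ℝ] U) :
    NormedSpace.exp D * NormedSpace.exp (-D) = 1 := by
  simpa using exp_neg_mul_exp (-D)

/-- The derivations of a bilinear operation. -/
def bilinDer (β : U →L[ℝ] U →L[ℝ] U) : Submodule ℝ (U →L[ℝ] U) where
  carrier := {D | ∀ u v, D (β u v) = β (D u) v + β u (D v)}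
  add_mem' := fun {D D'} h h' u v => by simp [h u v, h' u v]; abel
  zero_mem' := fun u v => by simp
  smul_mem' := fun c D h u v => by simp [h u v]

/-- The endomorphisms of a bilinear operation. -/
def IsBilinHom (β : U →L[ℝ] U →L[ℝ] U) (a : U →L[ℝ] U) : Prop :=
  ∀ u v, a (β u v) = β (a u) (a v)

/-- The failure of `D` to be a derivation. -/
noncomputable def derDefect (β : U →L[ℝ] U →L[ℝ] U) (D : U →L[ℝ] U) : U →L[ℝ] U →L[ℝ] U :=
  β ∘L D + (β.flip ∘L D).flip - (ContinuousLinearMap.compL ℝ U U U D) ∘L β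

theorem derDefect_apply (β : U →L[ℝ] U →L[ℝ] U) (D : U →L[ℝ] U) (u v : U) :
    derDefect β D u v = β (D u) v + β u (D v) - D (β u v) := rfl

theorem mem_bilinDer_of_derDefect_eq_zero {β : U →L[ℝ] U →L[ℝ] U} {D : U →L[ℝ] U}
    (h : derDefect β D = 0) : D ∈ bilinDer β := fun u v => by
  have := derDefect_apply β D u v
  rw [h] at this
  exact (sub_eq_zero.1 this.symm).symm

theorem conj_mem_bilinDer {β : U →L[ℝ] U →L[ℝ] U} {a a' D : U →L[ℝ] U} (ha : IsBilinHom β a)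
    (ha' : IsBilinHom β a') (h : a * a' = 1) (hD : D ∈ bilinDer β) :
    a * D * a' ∈ bilinDer β := by
  intro u v
  have h1 : ∀ w, a (a' w) = w := fun w => DFunLike.congr_fun h w
  simp only [mul_apply_eq_comp, ha' u v, hD _ _, map_add, ha _ _, h1]

variable [CompleteSpace U]

/-- The pullback of `β` along `exp (tD)` has as derivative the pullback of the defect of `D`. This
serves both directions between derivations and automorphisms. -/
theorem hasDerivAt_conj_exp (β : U →L[ℝ] U →L[ℝ] U) (D : U →L[ℝ] U) (u v : U) (t : ℝ) :
    HasDerivAt (fun t : ℝ => NormedSpace.exp (t • -D)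
      (β (NormedSpace.exp (t • D) u) (NormedSpace.exp (t • D) v)))
      (NormedSpace.exp (t • -D)
        (derDefect β D (NormedSpace.exp (t • D) u) (NormedSpace.exp (t • D) v))) t := by
  have h1 : ∀ w, HasDerivAt (fun t : ℝ => NormedSpace.exp (t • D) w)
      (D (NormedSpace.exp (t • D) w)) t := fun w =>
    (ContinuousLinearMap.apply ℝ U w).hasFDerivAt.comp_hasDerivAt t
      (hasDerivAt_exp_smul_const' D t)
  have h2 := (β.hasFDerivAt.comp_hasDerivAt t (h1 u)).clm_apply (h1 v)
  have h3 := (hasDerivAt_exp_smul_const (-D) t).clm_apply h2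
  refine h3.congr_deriv ?_
  simp only [derDefect_apply, mul_apply_eq_comp, neg_apply,
    map_neg, map_add, map_sub, Function.comp_apply]
  abel

theorem exp_isBilinHom {β : U →L[ℝ] U →L[ℝ] U} {D : U →L[ℝ] U} (hD : D ∈ bilinDer β) :
    IsBilinHom β (NormedSpace.exp D) := by
  intro u v
  have h0 : derDefect β D = 0 := by
    ext u v
    rw [derDefect_apply, hD u v, sub_self]; rfl
  have hd := hasDerivAt_conj_exp β D u v
  simp only [h0, zero_apply, map_zero] at hd
  have h := is_const_of_deriv_eq_zero (fun t => (hd t).differentiableAt) (fun t => (hd t).deriv) 1 0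
  simp only [one_smul, zero_smul, NormedSpace.exp_zero, one_apply_eq_self] at h
  rw [← h]
  exact DFunLike.congr_fun (exp_mul_exp_neg D) _

/-- If `exp D` preserves `β`, the pullback of `β` along `exp (tD)` is the same at `t = 0` and `t =
1`. For small `D` its velocity stays close to the defect `b`, within half of `‖b‖`; a curve that
returns to its start then forces `‖b‖ ≤ ‖b‖ / 2`, so `b = 0`. -/
theorem eventually_mem_bilinDer_of_isBilinHom_exp (β : U →L[ℝ] U →L[ℝ] U) :
    ∀ᶠ D : U →L[ℝ] U in 𝓝 0, IsBilinHom β (NormedSpace.exp D) → D ∈ bilinDer β := by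
  -- With `1/8` the three error terms below add up to `81/512 + 72/512 + 64/512 = 217/512`, less
  -- than `1/2`.
  have hcont : ∀ᶠ D : U →L[ℝ] U in 𝓝 0, ‖NormedSpace.exp D - 1‖ < 1 / 8 := by
    have h : Continuous fun D : U →L[ℝ] U => ‖NormedSpace.exp D - 1‖ :=
      (continuous_exp_endomorphism.sub continuous_const).norm
    exact h.continuousAt.eventually_lt_const (by simp)
  obtain ⟨δ, hδ, hball⟩ := Metric.eventually_nhds_iff_ball.1 hcont
  filter_upwards [Metric.ball_mem_nhds 0 hδ] with D hD hhom
  set b := derDefect β D with hb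
  have hsmall : ∀ t ∈ Set.Icc (0 : ℝ) 1, ‖NormedSpace.exp (t • D) - 1‖ ≤ 1 / 8 ∧
      ‖NormedSpace.exp (t • -D) - 1‖ ≤ 1 / 8 := by
    intro t ht
    rw [mem_ball_zero_iff] at hD
    have : ∀ D' : U →L[ℝ] U, ‖D'‖ = ‖D‖ → ‖NormedSpace.exp (t • D') - 1‖ ≤ 1 / 8 := by
      intro D' hD'
      refine (hball _ ?_).le
      rw [mem_ball_zero_iff, norm_smul, Real.norm_of_nonneg ht.1, hD']
      exact (mul_le_of_le_one_left (norm_nonneg _) ht.2).trans_lt hD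
    exact ⟨this D rfl, this (-D) (norm_neg D)⟩
  have hbound : ∀ u v, ‖b u v‖ ≤ 1 / 2 * ‖b‖ * ‖u‖ * ‖v‖ := by
    intro u v
    -- Subtracting `t • b u v` makes the velocity small; the total change over `[0, 1]` is then `-b
    -- u v`.
    have hd : ∀ t, HasDerivAt (fun t : ℝ => NormedSpace.exp (t • -D)
        (β (NormedSpace.exp (t • D) u) (NormedSpace.exp (t • D) v)) - t • b u v)
        (NormedSpace.exp (t • -D)
          (b (NormedSpace.exp (t • D) u) (NormedSpace.exp (t • D) v)) - b u v) t := by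
      intro t
      have h1 : HasDerivAt (fun t : ℝ => t • b u v) (b u v) t := by
        simpa using (hasDerivAt_id t).smul_const (b u v)
      exact (hasDerivAt_conj_exp β D u v t).sub h1
    have hle := norm_image_sub_le_of_norm_deriv_le_segment_01' (C := 1 / 2 * ‖b‖ * ‖u‖ * ‖v‖)
      (fun t _ => (hd t).hasDerivWithinAt) (by
        intro t ht
        obtain ⟨h1, h2⟩ := hsmall t ⟨ht.1, ht.2.le⟩
        set e := NormedSpace.exp (t • D)
        set e' := NormedSpace.exp (t • -D)
        have h3 : ∀ w, ‖e w - w‖ ≤ 1 / 8 * ‖w‖ := fun w =>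
          ((e - 1).le_opNorm w).trans (by gcongr)
        have h4 : ∀ w, ‖e' w - w‖ ≤ 1 / 8 * ‖w‖ := fun w =>
          ((e' - 1).le_opNorm w).trans (by gcongr)
        have h5 : ∀ w, ‖e w‖ ≤ 9 / 8 * ‖w‖ := fun w => by
          have := norm_le_norm_add_norm_sub' (e w) w
          linarith [h3 w]
        have h6 : e' (b (e u) (e v)) - b u v =
            (e' (b (e u) (e v)) - b (e u) (e v)) + b (e u - u) (e v) + b u (e v - v) := by
          simp only [map_sub, sub_apply]
          abel
        rw [h6]
        have hbl : ∀ x y, ‖b x y‖ ≤ ‖b‖ * ‖x‖ * ‖y‖ := b.le_opNorm₂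
        have k1 : ‖e' (b (e u) (e v)) - b (e u) (e v)‖ ≤
            1 / 8 * (‖b‖ * (9 / 8 * ‖u‖) * (9 / 8 * ‖v‖)) :=
          (h4 _).trans (by
            gcongr
            exact (hbl _ _).trans (by gcongr <;> exact h5 _))
        have k2 : ‖b (e u - u) (e v)‖ ≤ ‖b‖ * (1 / 8 * ‖u‖) * (9 / 8 * ‖v‖) :=
          (hbl _ _).trans (by gcongr; exacts [h3 _, h5 _])
        have k3 : ‖b u (e v - v)‖ ≤ ‖b‖ * ‖u‖ * (1 / 8 * ‖v‖) :=
          (hbl _ _).trans (by gcongr; exact h3 _)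
        have hpos : 0 ≤ ‖b‖ * ‖u‖ * ‖v‖ := by positivity
        calc _ ≤ _ := norm_add₃_le
          _ ≤ 1 / 8 * (‖b‖ * (9 / 8 * ‖u‖) * (9 / 8 * ‖v‖)) +
              ‖b‖ * (1 / 8 * ‖u‖) * (9 / 8 * ‖v‖) + ‖b‖ * ‖u‖ * (1 / 8 * ‖v‖) := by
            gcongr
          _ ≤ _ := by nlinarith [hpos])
    simp only [one_smul, zero_smul, NormedSpace.exp_zero, one_apply_eq_self,
      sub_zero, ← hhom u v] at hle
    have h7 : NormedSpace.exp (-D) (NormedSpace.exp D (β u v)) = β u v :=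
      DFunLike.congr_fun (exp_neg_mul_exp D) _
    rw [h7] at hle
    simpa using hle
  refine mem_bilinDer_of_derDefect_eq_zero ?_
  have hnorm := b.opNorm_le_bound₂ (by positivity) hbound
  have hb0 : ‖b‖ = 0 := le_antisymm (by linarith) b.opNorm_nonneg
  ext u v
  have := hbound u v
  rw [hb0, mul_zero, zero_mul, zero_mul, norm_le_zero_iff] at this
  rw [this]; rfl

theorem map_exp_nhds_zero : map (NormedSpace.exp : (U →L[ℝ] U) → _) (𝓝 0) = 𝓝 1 := by
  have h : HasStrictFDerivAt (NormedSpace.exp : (U →L[ℝ] U) → _)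
      ((ContinuousLinearEquiv.refl ℝ (U →L[ℝ] U) : _ ≃L[ℝ] _) : _ →L[ℝ] _) 0 :=
    hasStrictFDerivAt_exp_zero (𝕂 := ℝ)
  simpa using h.map_nhds_eq_of_equiv

/-- A differentiable multiplicative curve of operators is exponential. -/
theorem eq_exp_of_map_add {q : ℝ → U →L[ℝ] U} {X : U →L[ℝ] U} (h0 : q 0 = 1)
    (hadd : ∀ s t, q (s + t) = q s * q t) (hX : HasDerivAt q X 0) (t : ℝ) :
    q t = NormedSpace.exp (t • X) := by
  have hq : ∀ t, HasDerivAt q (X * q t) t := by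
    intro t
    have h1 : HasDerivAt (fun s => q (s - t)) X t := by
      have h := HasDerivAt.comp_sub_const (f := q) (f' := X) t t (by simpa using hX)
      exact h
    have h2 := h1.mul_const (q t)
    refine h2.congr_of_eventuallyEq (Eventually.of_forall fun s => ?_)
    simp only
    rw [← hadd, sub_add_cancel]
  have hc : ∀ t, HasDerivAt (fun t => NormedSpace.exp (t • -X) * q t) 0 t := by
    intro t
    refine ((hasDerivAt_exp_smul_const (-X) t).mul (hq t)).congr_deriv ?_
    simp [mul_assoc]
  have h := is_const_of_deriv_eq_zero (fun t => (hc t).differentiableAt) (fun t => (hc t).deriv) t 0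
  simp only [h0, zero_smul, NormedSpace.exp_zero, mul_one] at h
  calc q t = NormedSpace.exp (t • X) * NormedSpace.exp (-(t • X)) * q t := by
        rw [exp_mul_exp_neg, one_mul]
    _ = _ := by rw [mul_assoc, ← smul_neg, h, mul_one]

theorem hasDerivAt_comp_exp {F : Type*} [NormedAddCommGroup F] [NormedSpace ℝ F]
    {P : (U →L[ℝ] U) → F} (hP : DifferentiableAt ℝ P 1) (D : U →L[ℝ] U) :
    HasDerivAt (fun t : ℝ => P (NormedSpace.exp (t • D))) (fderiv ℝ P 1 D) 0 := by
  have h1 := hasDerivAt_exp_smul_const (𝕂 := ℝ) D 0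
  have h2 : HasFDerivAt P (fderiv ℝ P 1) (NormedSpace.exp ((0 : ℝ) • D)) := by
    simpa using hP.hasFDerivAt
  simpa [Function.comp_def] using h2.comp_hasDerivAt (0 : ℝ) h1

end BilinearAut

/-! ### The automorphism group and its exponentials -/

section AutExp

open Filter Topology

/-- Endomorphisms read in linear coordinates. -/
noncomputable def endCoords (E : Type*) [AddCommGroup E] [Module ℝ E] [FiniteDimensional ℝ E] :
    Module.End ℝ E ≃ₐ[ℝ]
      ((Fin (Module.finrank ℝ E) → ℝ) →L[ℝ] (Fin (Module.finrank ℝ E) → ℝ)) :=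
  ((linCoords E).conjAlgEquiv ℝ).trans (Module.End.toContinuousLinearMap _)

theorem endCoords_apply {E : Type*} [AddCommGroup E] [Module ℝ E] [FiniteDimensional ℝ E]
    (T : Module.End ℝ E) (v : Fin (Module.finrank ℝ E) → ℝ) :
    endCoords E T v = linCoords E (T ((linCoords E).symm v)) := rfl

variable {𝔤 : Type*} [LieRing 𝔤] [LieAlgebra ℝ 𝔤] [FiniteDimensional ℝ 𝔤]

variable (𝔤) in
/-- The Lie bracket in linear coordinates. -/
noncomputable def lieCoords : (Fin (Module.finrank ℝ 𝔤) → ℝ) →L[ℝ]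
    (Fin (Module.finrank ℝ 𝔤) → ℝ) →L[ℝ] (Fin (Module.finrank ℝ 𝔤) → ℝ) :=
  LinearMap.toContinuousBilinearMap (LinearMap.mk₂ ℝ
    (fun u v => linCoords 𝔤 ⁅(linCoords 𝔤).symm u, (linCoords 𝔤).symm v⁆)
    (by simp) (by simp) (by simp) (by simp))

theorem lieCoords_apply (u v : Fin (Module.finrank ℝ 𝔤) → ℝ) :
    lieCoords 𝔤 u v = linCoords 𝔤 ⁅(linCoords 𝔤).symm u, (linCoords 𝔤).symm v⁆ := rfl

variable (𝔤) in
/-- Automorphisms as operators in linear coordinates. -/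
noncomputable def autCoords : autGroup 𝔤 →*
    ((Fin (Module.finrank ℝ 𝔤) → ℝ) →L[ℝ] (Fin (Module.finrank ℝ 𝔤) → ℝ)) where
  toFun T := endCoords 𝔤 (autToEnd T)
  map_one' := map_one (endCoords 𝔤)
  map_mul' S T := map_mul (endCoords 𝔤) (autToEnd S) (autToEnd T)

theorem autCoords_apply (T : autGroup 𝔤) : autCoords 𝔤 T = endCoords 𝔤 (autToEnd T) := rfl

theorem autCoords_injective : Function.Injective (autCoords 𝔤) := fun S T h => by
  have h1 : autToEnd S = autToEnd T := (endCoords 𝔤).injective h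
  exact Subtype.ext (LinearEquiv.toLinearMap_injective h1)

/-- The operator-norm topology and the one read in a basis of `End 𝔤` agree, as linear isomorphisms
in finite dimension are homeomorphisms. -/
theorem isInducing_autCoords : IsInducing (autCoords 𝔤) := by
  set e : (Fin (Module.finrank ℝ (Module.End ℝ 𝔤)) → ℝ) ≃L[ℝ] _ :=
    ((linCoords (Module.End ℝ 𝔤)).symm.trans (endCoords 𝔤).toLinearEquiv).toContinuousLinearEquiv
  have h : (autCoords 𝔤 : autGroup 𝔤 → _) =
      e ∘ fun T : autGroup 𝔤 => linCoords (Module.End ℝ 𝔤) (autToEnd T) := by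
    funext T
    change endCoords 𝔤 (autToEnd T) =
      endCoords 𝔤 ((linCoords (Module.End ℝ 𝔤)).symm (linCoords (Module.End ℝ 𝔤) (autToEnd T)))
    rw [LinearEquiv.symm_apply_apply]
  rw [h]
  exact e.toHomeomorph.isInducing.comp ⟨rfl⟩

theorem autCoords_inv (T : autGroup 𝔤) : autCoords 𝔤 T⁻¹ = Ring.inverse (autCoords 𝔤 T) := by
  have h1 : autCoords 𝔤 T * autCoords 𝔤 T⁻¹ = 1 := by rw [← map_mul, mul_inv_cancel, map_one]
  have h2 : autCoords 𝔤 T⁻¹ * autCoords 𝔤 T = 1 := by rw [← map_mul, inv_mul_cancel, map_one]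
  exact (Ring.inverse_unit ⟨_, _, h1, h2⟩).symm

instance : IsTopologicalGroup (autGroup 𝔤) where
  continuous_mul := by
    rw [isInducing_autCoords.continuous_iff]
    have h := isInducing_autCoords.continuous (X := autGroup 𝔤)
    refine ((h.comp continuous_fst).mul (h.comp continuous_snd)).congr fun p => ?_
    exact (map_mul (autCoords 𝔤) p.1 p.2).symm
  continuous_inv := by
    rw [isInducing_autCoords.continuous_iff, continuous_iff_continuousAt]
    intro T
    have h1 : autCoords 𝔤 T * autCoords 𝔤 T⁻¹ = 1 := by rw [← map_mul, mul_inv_cancel, map_one]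
    have h2 : autCoords 𝔤 T⁻¹ * autCoords 𝔤 T = 1 := by rw [← map_mul, inv_mul_cancel, map_one]
    have h3 : ContinuousAt Ring.inverse (autCoords 𝔤 T) :=
      NormedRing.inverse_continuousAt ⟨_, _, h1, h2⟩
    have h4 := h3.comp isInducing_autCoords.continuous.continuousAt
    exact h4.congr (Eventually.of_forall fun S => (autCoords_inv S).symm)

instance : SecondCountableTopology (autGroup 𝔤) := by
  have : ProperSpace
      ((Fin (Module.finrank ℝ 𝔤) → ℝ) →L[ℝ] (Fin (Module.finrank ℝ 𝔤) → ℝ)) :=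
    FiniteDimensional.proper ℝ _
  exact isInducing_autCoords.secondCountableTopology

theorem isBilinHom_autCoords (T : autGroup 𝔤) : IsBilinHom (lieCoords 𝔤) (autCoords 𝔤 T) := by
  intro u v
  have hT : ∀ x y : 𝔤, autToEnd T ⁅x, y⁆ = ⁅autToEnd T x, autToEnd T y⁆ := T.2
  simp only [autCoords_apply, lieCoords_apply, endCoords_apply, LinearEquiv.symm_apply_apply, hT]

theorem exists_autCoords_eq {a a' : (Fin (Module.finrank ℝ 𝔤) → ℝ) →L[ℝ] _}
    (ha : IsBilinHom (lieCoords 𝔤) a) (h : a * a' = 1) (h' : a' * a = 1) :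
    ∃ T : autGroup 𝔤, autCoords 𝔤 T = a := by
  let T : 𝔤 ≃ₗ[ℝ] 𝔤 := LinearEquiv.ofLinearMap ((endCoords 𝔤).symm a) ((endCoords 𝔤).symm a')
    (by change (endCoords 𝔤).symm a * (endCoords 𝔤).symm a' = 1; rw [← map_mul, h, map_one])
    (by change (endCoords 𝔤).symm a' * (endCoords 𝔤).symm a = 1; rw [← map_mul, h', map_one])
  have hT : ∀ x, T x = (linCoords 𝔤).symm (a (linCoords 𝔤 x)) := by
    intro x
    have h1 := endCoords_apply ((endCoords 𝔤).symm a) (linCoords 𝔤 x)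
    rw [AlgEquiv.apply_symm_apply, LinearEquiv.symm_apply_apply] at h1
    rw [h1, LinearEquiv.symm_apply_apply]
    rfl
  refine ⟨⟨T, fun x y => ?_⟩, ?_⟩
  · have h1 := ha (linCoords 𝔤 x) (linCoords 𝔤 y)
    simp only [lieCoords_apply, LinearEquiv.symm_apply_apply] at h1
    rw [hT, hT, hT, h1, LinearEquiv.symm_apply_apply]
  · exact (endCoords 𝔤).apply_symm_apply a

theorem exists_autCoords_eq_exp
    {D : (Fin (Module.finrank ℝ 𝔤) → ℝ) →L[ℝ] (Fin (Module.finrank ℝ 𝔤) → ℝ)}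
    (hD : D ∈ bilinDer (lieCoords 𝔤)) : ∃ T : autGroup 𝔤, autCoords 𝔤 T = NormedSpace.exp D :=
  exists_autCoords_eq (exp_isBilinHom hD) (exp_mul_exp_neg D) (exp_neg_mul_exp D)

/-- The one-parameter subgroup generated by a derivation. -/
theorem exists_isOneParameterSubgroup
    {D : (Fin (Module.finrank ℝ 𝔤) → ℝ) →L[ℝ] (Fin (Module.finrank ℝ 𝔤) → ℝ)}
    (hD : D ∈ bilinDer (lieCoords 𝔤)) : ∃ γ : ℝ → autGroup 𝔤, IsOneParameterSubgroup γ ∧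
      Continuous γ ∧ ∀ t, autCoords 𝔤 (γ t) = NormedSpace.exp (t • D) := by
  choose γ hγ using fun t : ℝ => exists_autCoords_eq_exp (Submodule.smul_mem _ t hD)
  have hexp : ContDiff ℝ ∞ fun t : ℝ => NormedSpace.exp (t • D) := by
    have h1 : ContDiff ℝ ∞ (NormedSpace.exp :
        ((Fin (Module.finrank ℝ 𝔤) → ℝ) →L[ℝ] (Fin (Module.finrank ℝ 𝔤) → ℝ)) → _) :=
      contDiff_iff_contDiffAt.2 fun X => (NormedSpace.exp_analytic (𝕂 := ℝ) X).contDiffAt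
    exact h1.comp (by fun_prop)
  refine ⟨γ, ⟨?_, fun s t => ?_, ?_⟩, ?_, hγ⟩
  · refine autCoords_injective ?_
    rw [hγ, zero_smul, NormedSpace.exp_zero, map_one]
  · refine autCoords_injective ?_
    let +nondep : NormedAlgebra ℚ
        ((Fin (Module.finrank ℝ 𝔤) → ℝ) →L[ℝ] (Fin (Module.finrank ℝ 𝔤) → ℝ)) :=
      .restrictScalars ℚ ℝ _
    rw [map_mul, hγ, hγ, hγ, add_smul, NormedSpace.exp_add_of_commute]
    exact ((Commute.refl D).smul_left s).smul_right t
  · set e := ((endCoords 𝔤).symm.toLinearEquiv.trans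
      (linCoords (Module.End ℝ 𝔤))).toContinuousLinearEquiv
    convert e.contDiff.comp hexp using 1
    funext t
    change _ = linCoords (Module.End ℝ 𝔤) ((endCoords 𝔤).symm (NormedSpace.exp (t • D)))
    rw [← hγ, autCoords_apply, AlgEquiv.symm_apply_apply]
  · rw [isInducing_autCoords.continuous_iff]
    exact hexp.continuous.congr fun t => (hγ t).symm

/-- The velocity of a one-parameter subgroup of automorphisms is a derivation. -/
theorem IsOneParameterSubgroup.exists_hasDerivAt {γ : ℝ → autGroup 𝔤}
    (hγ : IsOneParameterSubgroup γ) :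
    ∃ D ∈ bilinDer (lieCoords 𝔤), HasDerivAt (fun t => autCoords 𝔤 (γ t)) D 0 := by
  set e := ((linCoords (Module.End ℝ 𝔤)).symm.trans
    (endCoords 𝔤).toLinearEquiv).toContinuousLinearEquiv
  have h1 : ContDiff ℝ ∞ fun t => autCoords 𝔤 (γ t) := by
    convert e.contDiff.comp hγ.smooth using 1
    funext t
    change endCoords 𝔤 (autToEnd (γ t)) = endCoords 𝔤 ((linCoords (Module.End ℝ 𝔤)).symm
      (linCoords (Module.End ℝ 𝔤) (autToEnd (γ t))))
    rw [LinearEquiv.symm_apply_apply]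
  have h2 := (h1.differentiable (by simp) 0).hasDerivAt
  refine ⟨_, fun u v => ?_, h2⟩
  set D := deriv (fun t => autCoords 𝔤 (γ t)) 0
  have h3 : ∀ w, HasDerivAt (fun t => autCoords 𝔤 (γ t) w) (D w) 0 := fun w =>
    (ContinuousLinearMap.apply ℝ (Fin (Module.finrank ℝ 𝔤) → ℝ) w).hasFDerivAt.comp_hasDerivAt
      (0 : ℝ) h2
  have h4 := ((lieCoords 𝔤).hasFDerivAt.comp_hasDerivAt 0 (h3 u)).clm_apply (h3 v)
  have h5 := h3 (lieCoords 𝔤 u v)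
  have h6 : (fun t => autCoords 𝔤 (γ t) (lieCoords 𝔤 u v)) =
      fun t => lieCoords 𝔤 (autCoords 𝔤 (γ t) u) (autCoords 𝔤 (γ t) v) := by
    funext t
    exact isBilinHom_autCoords (γ t) u v
  rw [h6] at h5
  have h7 := h5.unique h4
  rw [h7, Function.comp_apply, hγ.map_zero, map_one]
  rfl

variable {E : Type*} [AddCommGroup E] [Module ℝ E] [FiniteDimensional ℝ E]

/-- A representation of `Aut(𝔤)` which is the restriction of a function on `𝔤𝔩(𝔤)` that is
differentiable at the identity. -/
def IsSmoothRepresentation (ρ : Representation ℝ (autGroup 𝔤) E) : Prop :=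
  ∃ P : ((Fin (Module.finrank ℝ 𝔤) → ℝ) →L[ℝ] (Fin (Module.finrank ℝ 𝔤) → ℝ)) →
      ((Fin (Module.finrank ℝ E) → ℝ) →L[ℝ] (Fin (Module.finrank ℝ E) → ℝ)),
    DifferentiableAt ℝ P 1 ∧ ∀ T, endCoords E (ρ T) = P (autCoords 𝔤 T)

namespace IsSmoothRepresentation

variable {ρ : Representation ℝ (autGroup 𝔤) E}

/-- A smooth representation in linear coordinates, with its infinitesimal generators. -/
noncomputable def expAction (hρ : IsSmoothRepresentation ρ) :
    ExpAction (autGroup 𝔤) (Fin (Module.finrank ℝ E) → ℝ) where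
  rep := (MonoidHomClass.toMonoidHom (endCoords E)).comp ρ
  gen := (bilinDer (lieCoords 𝔤)).map (fderiv ℝ hρ.choose 1).toLinearMap
  conj_mem := by
    rintro g _ ⟨D, hD, rfl⟩
    obtain ⟨hP, hPρ⟩ := hρ.choose_spec
    set P := hρ.choose
    have hg : autCoords 𝔤 g * autCoords 𝔤 g⁻¹ = 1 := by
      rw [← map_mul, mul_inv_cancel, map_one]
    have hg' : autCoords 𝔤 g⁻¹ * autCoords 𝔤 g = 1 := by
      rw [← map_mul, inv_mul_cancel, map_one]
    obtain ⟨γ, -, -, hγ⟩ := exists_isOneParameterSubgroup hD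
    refine ⟨_, conj_mem_bilinDer (isBilinHom_autCoords g) (isBilinHom_autCoords g⁻¹) hg hD, ?_⟩
    have h1 := ((hasDerivAt_comp_exp hP D).const_mul (endCoords E (ρ g))).mul_const
      (endCoords E (ρ g⁻¹))
    have h2 := hasDerivAt_comp_exp hP (autCoords 𝔤 g * D * autCoords 𝔤 g⁻¹)
    -- Both derivatives belong to the same curve, `ρ (g exp(tD) g⁻¹) = ρ(g) ρ(exp(tD)) ρ(g⁻¹)`.
    refine h2.unique (h1.congr_of_eventuallyEq (Eventually.of_forall fun t => ?_))
    let +nondep : NormedAlgebra ℚ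
        ((Fin (Module.finrank ℝ 𝔤) → ℝ) →L[ℝ] (Fin (Module.finrank ℝ 𝔤) → ℝ)) :=
      .restrictScalars ℚ ℝ _
    have h3 : NormedSpace.exp (t • (autCoords 𝔤 g * D * autCoords 𝔤 g⁻¹)) =
        autCoords 𝔤 (g * γ t * g⁻¹) := by
      have h4 := NormedSpace.exp_units_conj ⟨_, _, hg, hg'⟩ (t • D)
      rw [map_mul, map_mul, hγ]
      simpa using h4
    simp only
    rw [h3, ← hγ, ← hPρ, ← hPρ, ← map_mul, ← map_mul, map_mul ρ, map_mul ρ]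
  exists_path := by
    rintro _ ⟨D, hD, rfl⟩
    obtain ⟨hP, hPρ⟩ := hρ.choose_spec
    set P := hρ.choose
    obtain ⟨γ, hγ1, hγ2, hγ⟩ := exists_isOneParameterSubgroup hD
    refine ⟨γ, hγ2, hγ1.map_zero, fun t => ?_⟩
    refine eq_exp_of_map_add (q := fun t => endCoords E (ρ (γ t))) ?_ ?_ ?_ t
    · simp only [hγ1.map_zero, map_one]
    · intro s t
      simp only [hγ1.map_add, map_mul]
    · refine (hasDerivAt_comp_exp hP D).congr_of_eventuallyEq (Eventually.of_forall fun t => ?_)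
      simp only
      rw [← hγ, ← hPρ]
  map_nhds_one_le := by
    intro s hs
    obtain ⟨hP, hPρ⟩ := hρ.choose_spec
    set P := hρ.choose
    set c : bilinDer (lieCoords 𝔤) →
        (bilinDer (lieCoords 𝔤)).map (fderiv ℝ P 1).toLinearMap :=
      fun D => ⟨fderiv ℝ P 1 D, D, D.2, rfl⟩ with hc
    have hcont : Tendsto c (𝓝 0) (𝓝 0) := by
      have h : Continuous c := by fun_prop
      convert h.tendsto 0
      exact Subtype.ext (by simp [hc])
    have h1 : ∀ᶠ D : bilinDer (lieCoords 𝔤) in 𝓝 0, NormedSpace.exp (fderiv ℝ P 1 D) ∈ s :=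
      hcont.eventually (mem_map.1 hs)
    rw [nhds_subtype_eq_comap, eventually_comap] at h1
    -- Operators near `1` are `exp D` with `D` small; if such an operator preserves the bracket, `D`
    -- is a derivation, and its image under the differential is a small generator.
    have h2 : ∀ᶠ a in 𝓝 1, IsBilinHom (lieCoords 𝔤) a → ∃ D ∈ bilinDer (lieCoords 𝔤),
        a = NormedSpace.exp D ∧ NormedSpace.exp (fderiv ℝ P 1 D) ∈ s := by
      rw [← map_exp_nhds_zero, eventually_map]
      filter_upwards [h1, eventually_mem_bilinDer_of_isBilinHom_exp (lieCoords 𝔤)] with D hD hD' h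
      exact ⟨D, hD' h, rfl, hD ⟨D, hD' h⟩ rfl⟩
    have h3 : Tendsto (autCoords 𝔤) (𝓝 1) (𝓝 1) := by
      simpa using isInducing_autCoords.continuous.tendsto (1 : autGroup 𝔤)
    refine mem_map.2 ?_
    filter_upwards [h3.eventually h2] with T hT
    obtain ⟨D, hD, hTD, hDs⟩ := hT (isBilinHom_autCoords T)
    obtain ⟨γ, hγ1, -, hγ⟩ := exists_isOneParameterSubgroup hD
    have h4 : T = γ 1 := autCoords_injective (by rw [hTD, hγ, one_smul])
    have h5 := eq_exp_of_map_add (q := fun t => endCoords E (ρ (γ t)))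
      (X := fderiv ℝ P 1 D) (by simp only [hγ1.map_zero, map_one])
      (fun s t => by simp only [hγ1.map_add, map_mul])
      ((hasDerivAt_comp_exp hP D).congr_of_eventuallyEq (Eventually.of_forall fun t => by
        simp only
        rw [← hγ, ← hPρ])) 1
    rw [one_smul] at h5
    rw [Set.mem_preimage, h4]
    exact h5 ▸ hDs

theorem expAction_rep (hρ : IsSmoothRepresentation ρ) (T : autGroup 𝔤) :
    hρ.expAction.rep T = endCoords E (ρ T) := rfl

theorem expAction_rep_apply (hρ : IsSmoothRepresentation ρ) (T : autGroup 𝔤) (x : E) :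
    hρ.expAction.rep T (linCoords E x) = linCoords E (ρ T x) := by
  rw [expAction_rep, endCoords_apply, LinearEquiv.symm_apply_apply]

/-- The fundamental distribution is spanned by the infinitesimal generators. -/
theorem fundamentalDistribution_eq (hρ : IsSmoothRepresentation ρ) (x : E) :
    fundamentalDistribution ρ x =
      (evalDist hρ.expAction.gen (linCoords E x)).comap (linCoords E).toLinearMap := by
  obtain ⟨hP, hPρ⟩ := hρ.choose_spec
  have hgen : hρ.expAction.gen =
    (bilinDer (lieCoords 𝔤)).map (fderiv ℝ hρ.choose 1).toLinearMap := rfl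
  set P := hρ.choose
  have hval : ∀ (T : autGroup 𝔤) (w : E),
      linCoords E (ρ T w) = P (autCoords 𝔤 T) (linCoords E w) := fun T w => by
    rw [← hPρ, endCoords_apply, LinearEquiv.symm_apply_apply]
  refine le_antisymm (Submodule.span_le.2 ?_) ?_
  · rintro _ ⟨X, ⟨γ, hγ, hX⟩, rfl⟩
    obtain ⟨D, hD, hγD⟩ := hγ.exists_hasDerivAt
    refine mem_evalDist.2 ⟨fderiv ℝ P 1 D, hgen ▸ ⟨D, hD, rfl⟩, ?_⟩
    have h1 : HasFDerivAt P (fderiv ℝ P 1) (autCoords 𝔤 (γ 0)) := by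
      rw [hγ.map_zero, map_one]; exact hP.hasFDerivAt
    have h2 : HasDerivAt (fun t => P (autCoords 𝔤 (γ t))) (fderiv ℝ P 1 D) 0 :=
      h1.comp_hasDerivAt (0 : ℝ) hγD
    have h3 : HasDerivAt (fun t => P (autCoords 𝔤 (γ t)) (linCoords E x))
        (fderiv ℝ P 1 D (linCoords E x)) 0 :=
      (ContinuousLinearMap.apply ℝ (Fin (Module.finrank ℝ E) → ℝ)
        (linCoords E x)).hasFDerivAt.comp_hasDerivAt (0 : ℝ) h2
    have h4 := hX x
    simp only [hval] at h4
    exact h3.unique h4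
  · intro u hu
    obtain ⟨_, ⟨D, hD, rfl⟩, hDu⟩ := mem_evalDist.1 (show linCoords E u ∈ _ from hu)
    obtain ⟨γ, hγ1, -, hγ⟩ := exists_isOneParameterSubgroup hD
    refine Submodule.subset_span
      ⟨fun w => (linCoords E).symm (fderiv ℝ P 1 D (linCoords E w)), ⟨γ, hγ1, fun w => ?_⟩, ?_⟩
    · simp only [hval, hγ, LinearEquiv.apply_symm_apply]
      exact (ContinuousLinearMap.apply ℝ (Fin (Module.finrank ℝ E) → ℝ)
        (linCoords E w)).hasFDerivAt.comp_hasDerivAt (0 : ℝ) (hasDerivAt_comp_exp hP D)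
    · refine (linCoords E).injective ?_
      simp only [LinearEquiv.apply_symm_apply]
      exact hDu.symm

end IsSmoothRepresentation

end AutExp

/-! ### The actions on bivectors and reduced bivectors -/

section BivectorActions

variable {𝔤 : Type*} [LieRing 𝔤] [LieAlgebra ℝ 𝔤]

theorem coe_exteriorPower_map (a : Module.End ℝ 𝔤) (q : Bivector 𝔤) :
    (exteriorPower.map 2 a q : ExteriorAlgebra ℝ 𝔤) =
      ExteriorAlgebra.map a (q : ExteriorAlgebra ℝ 𝔤) := by
  have h : (⋀[ℝ]^2 𝔤).subtype ∘ₗ exteriorPower.map 2 a =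
      (ExteriorAlgebra.map a).toLinearMap ∘ₗ (⋀[ℝ]^2 𝔤).subtype := by
    ext m
    simp
    rfl
  exact LinearMap.congr_fun h q

/-- The quadratic map `a ↦ Λ²a` is the diagonal of half of this bilinear map. -/
noncomputable def polarMap (𝔤 : Type*) [LieRing 𝔤] [LieAlgebra ℝ 𝔤] :
    Module.End ℝ 𝔤 →ₗ[ℝ] Module.End ℝ 𝔤 →ₗ[ℝ] Module.End ℝ (Bivector 𝔤) := by
  refine LinearMap.mk₂ ℝ
    (fun a c => exteriorPower.map 2 (a + c) - exteriorPower.map 2 a - exteriorPower.map 2 c)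
    (fun a a' c => ?_) (fun t a c => ?_) (fun a c c' => ?_) (fun t a c => ?_)
  all_goals
    refine LinearMap.ext fun ⟨q, hq⟩ => Subtype.ext ?_
    simp only [LinearMap.sub_apply, LinearMap.add_apply, LinearMap.smul_apply, Submodule.coe_sub,
      Submodule.coe_add, Submodule.coe_smul, coe_exteriorPower_map]
    refine bivector_induction ?_ ?_ hq
    · intro x y
      simp only [map_mul, ExteriorAlgebra.map_apply_ι, LinearMap.add_apply, LinearMap.smul_apply,
        map_add, map_smul, mul_add, add_mul, smul_mul_assoc, mul_smul_comm]
      module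
    · intro P Q hP hQ
      simp only [map_add]
      linear_combination (norm := module) hP + hQ

theorem polarMap_self (a : Module.End ℝ 𝔤) :
    exteriorPower.map 2 a = (1 / 2 : ℝ) • polarMap 𝔤 a a := by
  refine LinearMap.ext fun ⟨q, hq⟩ => Subtype.ext ?_
  change _ = (((1 / 2 : ℝ) • (exteriorPower.map 2 (a + a) - exteriorPower.map 2 a -
    exteriorPower.map 2 a) : Module.End ℝ (Bivector 𝔤)) ⟨q, hq⟩ : ExteriorAlgebra ℝ 𝔤)
  simp only [LinearMap.sub_apply, LinearMap.smul_apply, Submodule.coe_sub,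
    Submodule.coe_smul, coe_exteriorPower_map]
  refine bivector_induction ?_ ?_ hq
  · intro x y
    simp only [map_mul, ExteriorAlgebra.map_apply_ι, LinearMap.add_apply, map_add, mul_add, add_mul]
    module
  · intro P Q hP hQ
    simp only [map_add]
    linear_combination (norm := module) hP + hQ

variable [FiniteDimensional ℝ 𝔤]

variable (𝔤) in
-- `T ↦ Λ²T` is the restriction of a quadratic map on all of `End 𝔤`.
theorem isSmoothRepresentation_bivectorAction : IsSmoothRepresentation (bivectorAction 𝔤) := by
  set B := LinearMap.toContinuousBilinearMap (((polarMap 𝔤).compl₁₂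
    (endCoords 𝔤).symm.toLinearMap (endCoords 𝔤).symm.toLinearMap).compr₂
      (endCoords (Bivector 𝔤)).toLinearMap) with hB
  refine ⟨fun a => (1 / 2 : ℝ) • B a a, ?_, fun T => ?_⟩
  · exact (B.differentiableAt.clm_apply differentiableAt_id).const_smul (1 / 2 : ℝ)
  · change endCoords (Bivector 𝔤) (exteriorPower.map 2 (autToEnd T)) = (1 / 2 : ℝ) •
      endCoords (Bivector 𝔤) (polarMap 𝔤 ((endCoords 𝔤).symm (endCoords 𝔤 (autToEnd T)))
        ((endCoords 𝔤).symm (endCoords 𝔤 (autToEnd T))))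
    rw [AlgEquiv.symm_apply_apply, ← map_smul, ← polarMap_self]

/-- For a linear section `s` of the projection `π`, the quotient operator is `π ∘ ρ T ∘ s`, which is
linear in `ρ T`. -/
theorem IsSmoothRepresentation.quotient {E : Type*} [AddCommGroup E] [Module ℝ E]
    [FiniteDimensional ℝ E] {ρ : Representation ℝ (autGroup 𝔤) E} (hρ : IsSmoothRepresentation ρ)
    (W : Submodule ℝ E) (hW : ∀ T, W ≤ W.comap (ρ T)) :
    IsSmoothRepresentation (ρ.quotient W hW) := by
  obtain ⟨P, hP, hPρ⟩ := hρ
  obtain ⟨s, hs⟩ := W.mkQ.exists_rightInverse_of_surjective W.range_mkQ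
  let R : ((Fin (Module.finrank ℝ E) → ℝ) →L[ℝ] (Fin (Module.finrank ℝ E) → ℝ)) →ₗ[ℝ]
      ((Fin (Module.finrank ℝ (E ⧸ W)) → ℝ) →L[ℝ] (Fin (Module.finrank ℝ (E ⧸ W)) → ℝ)) :=
    { toFun := fun b => endCoords (E ⧸ W) (W.mkQ ∘ₗ (endCoords E).symm b ∘ₗ s)
      map_add' := fun b c => by
        rw [map_add, LinearMap.add_comp, LinearMap.comp_add, map_add]
      map_smul' := fun t b => by
        rw [map_smul, LinearMap.smul_comp, LinearMap.comp_smul, map_smul, RingHom.id_apply] }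
  refine ⟨fun a => R.toContinuousLinearMap (P a),
    R.toContinuousLinearMap.differentiableAt.comp _ hP, fun T => ?_⟩
  change _ = R (P (autCoords 𝔤 T))
  rw [← hPρ]
  change _ = endCoords (E ⧸ W) (W.mkQ ∘ₗ (endCoords E).symm (endCoords E (ρ T)) ∘ₗ s)
  rw [AlgEquiv.symm_apply_apply]
  congr 1
  refine LinearMap.ext fun w => ?_
  have hw : W.mkQ (s w) = w := LinearMap.congr_fun hs w
  conv_lhs => rw [← hw]
  rfl

variable (𝔤) in
theorem isSmoothRepresentation_reducedAction : IsSmoothRepresentation (reducedAction 𝔤) :=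
  (isSmoothRepresentation_bivectorAction 𝔤).quotient _ _

/-! ### Equivariance, cocommutator classes and orbits -/

theorem map_schouten_bivector (T : autGroup 𝔤) {P Q : ExteriorAlgebra ℝ 𝔤} (hP : P ∈ ⋀[ℝ]^2 𝔤) :
    ExteriorAlgebra.map (autToEnd T) (schouten P Q) =
      schouten (ExteriorAlgebra.map (autToEnd T) P) (ExteriorAlgebra.map (autToEnd T) Q) := by
  refine bivector_induction (p := fun P => ExteriorAlgebra.map (autToEnd T) (schouten P Q) =
    schouten (ExteriorAlgebra.map (autToEnd T) P) (ExteriorAlgebra.map (autToEnd T) Q)) ?_ ?_ hP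
  · intro x y
    simp only [schouten_ι_mul_ι_left, map_sub, map_mul, ExteriorAlgebra.map_apply_ι, map_schouten_ι]
  · intro P P' hP hP'
    simp only [map_add, LinearMap.add_apply, hP, hP']

theorem IsRMatrix.map {r : Bivector 𝔤} (hr : IsRMatrix r) (T : autGroup 𝔤) :
    IsRMatrix (bivectorAction 𝔤 T r) := by
  rw [isRMatrix_iff_mem_mCYBESolutions] at hr ⊢
  refine ⟨schouten_mem (bivectorAction 𝔤 T r).2 (bivectorAction 𝔤 T r).2, fun v => ?_⟩
  have hv : autToEnd T (autToEnd T⁻¹ v) = v := LinearEquiv.apply_symm_apply T.1 v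
  rw [coe_bivectorAction, ← map_schouten_bivector T r.2, ← hv, ← map_schouten_ι, hr.2, map_zero]

theorem coboundary_bivectorAction (T : autGroup 𝔤) (r : Bivector 𝔤) (v : 𝔤) :
    coboundary (bivectorAction 𝔤 T r) (autToEnd T v) = bivectorAction 𝔤 T (coboundary r v) := by
  refine Subtype.ext ?_
  rw [coe_coboundary, coe_bivectorAction, coe_bivectorAction, coe_coboundary, map_schouten_ι]

/-- The kernel of `r ↦ δ_r` is the space of invariant bivectors, so coboundary cocommutators live
naturally on the quotient. -/
theorem coboundary_eq_coboundary_iff {r s : Bivector 𝔤} :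
    coboundary r = coboundary s ↔
      (invariantBivectors 𝔤).mkQ r = (invariantBivectors 𝔤).mkQ s := by
  rw [Submodule.mkQ_apply, Submodule.mkQ_apply, Submodule.Quotient.eq]
  constructor
  · intro h v
    have h1 := congrArg Subtype.val (LinearMap.congr_fun h v)
    rw [coe_coboundary, coe_coboundary] at h1
    rw [Submodule.coe_sub, map_sub, h1, sub_self]
  · intro h
    refine LinearMap.ext fun v => Subtype.ext ?_
    have h1 := h v
    rw [Submodule.coe_sub, map_sub, sub_eq_zero] at h1
    exact h1

theorem cocommutatorEquiv_coboundary_iff {r : Bivector 𝔤} {δ : 𝔤 →ₗ[ℝ] Bivector 𝔤} :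
    CocommutatorEquiv (coboundary r) δ ↔
      ∃ T : autGroup 𝔤, δ = coboundary (bivectorAction 𝔤 T r) := by
  refine exists_congr fun T => ⟨fun h => LinearMap.ext fun v => ?_, fun h v => ?_⟩
  · have hv : autToEnd T (autToEnd T⁻¹ v) = v := LinearEquiv.apply_symm_apply T.1 v
    rw [← hv, ← h, coboundary_bivectorAction]
  · rw [h, coboundary_bivectorAction]

/-- The class of `δ_r` consists of the cocommutators of the bivectors over the orbit of `r`. -/
theorem mem_cocommutatorClass_iff {r : Bivector 𝔤} (hr : IsRMatrix r)
    {δ : 𝔤 →ₗ[ℝ] Bivector 𝔤} :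
    (IsCoboundaryCocommutator δ ∧ CocommutatorEquiv (coboundary r) δ) ↔
      ∃ q : Bivector 𝔤, δ = coboundary q ∧ (invariantBivectors 𝔤).mkQ q ∈
        Set.range fun T : autGroup 𝔤 => reducedAction 𝔤 T ((invariantBivectors 𝔤).mkQ r) := by
  rw [cocommutatorEquiv_coboundary_iff]
  constructor
  · rintro ⟨-, T, rfl⟩
    exact ⟨_, rfl, T, rfl⟩
  · rintro ⟨q, rfl, T, hT⟩
    have h : coboundary q = coboundary (bivectorAction 𝔤 T r) :=
      coboundary_eq_coboundary_iff.2 hT.symm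
    rw [h]
    exact ⟨⟨hr.map T, _, rfl⟩, T, rfl⟩

theorem mkQ_image_cocommutatorClass {r : Bivector 𝔤} (hr : IsRMatrix r) :
    (invariantBivectors 𝔤).mkQ '' {q | coboundary q ∈
      {δ | IsCoboundaryCocommutator δ ∧ CocommutatorEquiv (coboundary r) δ}} =
      Set.range fun T : autGroup 𝔤 => reducedAction 𝔤 T ((invariantBivectors 𝔤).mkQ r) := by
  ext p
  constructor
  · rintro ⟨q, hq, rfl⟩
    obtain ⟨q', hqq', hq'⟩ := (mem_cocommutatorClass_iff hr).1 hq
    rwa [coboundary_eq_coboundary_iff.1 hqq']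
  · intro hp
    obtain ⟨q, rfl⟩ := (invariantBivectors 𝔤).mkQ_surjective p
    exact ⟨q, (mem_cocommutatorClass_iff hr).2 ⟨q, rfl, hp⟩, rfl⟩

theorem IsSmoothRepresentation.mem_stratum_iff {E : Type*} [AddCommGroup E] [Module ℝ E]
    [FiniteDimensional ℝ E] {ρ : Representation ℝ (autGroup 𝔤) E} (hρ : IsSmoothRepresentation ρ)
    {x y : E} : y ∈ hρ.expAction.stratum x ↔ ∃ T ∈ autConnected 𝔤, ρ T x = y := by
  refine exists_congr fun T => and_congr_right fun _ => ?_
  simp only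
  rw [hρ.expAction_rep_apply, (linCoords E).injective.eq_iff]

/-- The orbits of `Aut(𝔤)` are countable unions of strata of the same dimension. -/
theorem IsSmoothRepresentation.exists_countable_strata {E : Type*} [AddCommGroup E] [Module ℝ E]
    [FiniteDimensional ℝ E] {ρ : Representation ℝ (autGroup 𝔤) E} (hρ : IsSmoothRepresentation ρ)
    (p : E) : ∃ (k : ℕ) (F : Set (Set E)), F.Countable ∧
      F ⊆ strataOfDim (fundamentalDistribution ρ) k ∧
      (Set.range fun T : autGroup 𝔤 => ρ T p) = ⋃₀ F := by
  set A := hρ.expAction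
  have hD := hρ.fundamentalDistribution_eq
  refine ⟨Module.finrank ℝ (evalDist A.gen (linCoords E p)),
    Set.range fun T : autGroup 𝔤 => A.stratum (ρ T p), ?_, ?_, ?_⟩
  -- Orbits of the identity component are open in the leaf topology and the orbit map is continuous,
  -- so `T ↦ A.stratum (ρ T p)` has open fibres. Disjoint nonempty open sets in a second countable
  -- group are countably many.
  · have hopen : ∀ S ∈ Set.range fun T : autGroup 𝔤 => A.stratum (ρ T p),
        IsOpen {T : autGroup 𝔤 | A.stratum (ρ T p) = S} := by
      rintro _ ⟨T₀, rfl⟩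
      convert (A.isOpen_orbit₀ (linCoords E (ρ T₀ p))).preimage
        (A.continuous_orbitMap (linCoords E p)) using 1
      ext T
      simp only [Set.mem_preimage, Set.mem_ofPred_eq]
      constructor
      · intro h
        refine ⟨_, ?_, rfl⟩
        have h1 : ρ T p ∈ A.stratum (ρ T₀ p) := h ▸ A.mem_stratum_self _
        rw [hρ.expAction_rep_apply]
        exact h1
      · rintro ⟨y, hy, hyT⟩
        obtain rfl : y = _ := congrArg ExpAction.Leaf.ofLeaf hyT
        refine A.stratum_eq_of_mem ?_
        change linCoords E (ρ T p) ∈ A.orbit₀ (linCoords E (ρ T₀ p))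
        exact hρ.expAction_rep_apply T p ▸ hy
    refine Set.PairwiseDisjoint.countable_of_isOpen (s := fun S : Set E =>
      {T : autGroup 𝔤 | A.stratum (ρ T p) = S}) ?_ hopen ?_
    · intro S _ S' _ hne
      refine Set.disjoint_left.2 fun T hT hT' => hne ?_
      exact hT.symm.trans hT'
    · rintro _ ⟨T, rfl⟩
      exact ⟨T, rfl⟩
  · rintro _ ⟨T, rfl⟩
    refine ⟨A.strata_eq hD ▸ ⟨_, rfl⟩, ?_⟩
    have h := A.isConnectedIntegralSubmanifold_stratum hD (ρ T p)
    rwa [← hρ.expAction_rep_apply, A.finrank_evalDist_rep] at h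
  · ext y
    simp only [Set.sUnion_range, Set.mem_iUnion]
    constructor
    · rintro ⟨T, rfl⟩
      exact ⟨T, A.mem_stratum_self _⟩
    · rintro ⟨T, hy⟩
      obtain ⟨T', -, rfl⟩ := hρ.mem_stratum_iff.1 hy
      exact ⟨T' * T, by simp only [map_mul]; rfl⟩

end BivectorActions

/-! ### The classification theorem -/

theorem mainTheorem2 (𝔤 : Type*) [LieRing 𝔤] [LieAlgebra ℝ 𝔤] [FiniteDimensional ℝ 𝔤] :
    (IsIntegralStratification (fundamentalDistribution (bivectorAction 𝔤))
        (strata (fundamentalDistribution (bivectorAction 𝔤))) ∧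
      IsIntegralStratification (fundamentalDistribution (reducedAction 𝔤))
        (strata (fundamentalDistribution (reducedAction 𝔤)))) ∧
    rMatrixClasses 𝔤 =
      {S | S ∈ strata (fundamentalDistribution (bivectorAction 𝔤)) ∧ S ⊆ mCYBESolutions 𝔤} ∧
    Set.BijOn (fun C => (invariantBivectors 𝔤).mkQ '' {r | coboundary r ∈ C})
      (cocommutatorClasses 𝔤) (reducedOrbits 𝔤) ∧
    ∀ O ∈ reducedOrbits 𝔤, ∃ (k : ℕ) (F : Set (Set (ReducedBivector 𝔤))),
      F.Countable ∧ F ⊆ strataOfDim (fundamentalDistribution (reducedAction 𝔤)) k ∧ O = ⋃₀ F := by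
  have hb := isSmoothRepresentation_bivectorAction 𝔤
  have hr := isSmoothRepresentation_reducedAction 𝔤
  have hbs := hb.expAction.strata_eq hb.fundamentalDistribution_eq
  refine ⟨⟨?_, ?_⟩, ?_, ⟨?_, ?_, ?_⟩, ?_⟩
  · rw [hbs]
    exact hb.expAction.isIntegralStratification_range_stratum hb.fundamentalDistribution_eq
  · rw [hr.expAction.strata_eq hr.fundamentalDistribution_eq]
    exact hr.expAction.isIntegralStratification_range_stratum hr.fundamentalDistribution_eq
  -- Automorphisms preserve `r`-matrices, so the condition on `r'` in a class is automatic and the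
  -- class is the whole orbit of `Aut_c(𝔤)`.
  · have hclass : ∀ r : Bivector 𝔤, IsRMatrix r →
        {r' | IsRMatrix r' ∧ ∃ T ∈ autConnected 𝔤, bivectorAction 𝔤 T r = r'} =
          hb.expAction.stratum r := by
      intro r hr
      ext r'
      rw [hb.mem_stratum_iff]
      refine ⟨fun h => h.2, fun h => ⟨?_, h⟩⟩
      obtain ⟨T, -, rfl⟩ := h
      exact hr.map T
    rw [hbs]
    ext S
    constructor
    · rintro ⟨r, hr, rfl⟩
      exact ⟨⟨r, (hclass r hr).symm⟩, fun r' hr' => (isRMatrix_iff_mem_mCYBESolutions r').1 hr'.1⟩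
    · rintro ⟨⟨r, rfl⟩, hS⟩
      have hr := (isRMatrix_iff_mem_mCYBESolutions r).2 (hS (hb.expAction.mem_stratum_self r))
      exact ⟨r, hr, (hclass r hr).symm⟩
  · rintro _ ⟨_, ⟨hδ, r, rfl⟩, rfl⟩
    exact ⟨_, ⟨r, (isRMatrix_iff_mem_mCYBESolutions r).1 hδ, rfl⟩, mkQ_image_cocommutatorClass hδ⟩
  · rintro _ ⟨_, ⟨hδ, r, rfl⟩, rfl⟩ _ ⟨_, ⟨hδ', s, rfl⟩, rfl⟩ h
    -- Injectivity: a class consists of all `δ_q` with `q` over its orbit, so equal orbits give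
    -- equal classes.
    have h1 := (mkQ_image_cocommutatorClass hδ).symm.trans
      (h.trans (mkQ_image_cocommutatorClass hδ'))
    ext δ
    rw [Set.mem_ofPred_eq, Set.mem_ofPred_eq, mem_cocommutatorClass_iff hδ,
      mem_cocommutatorClass_iff hδ', h1]
  · rintro _ ⟨_, ⟨r, hr, rfl⟩, rfl⟩
    have hr' : IsRMatrix r := (isRMatrix_iff_mem_mCYBESolutions r).2 hr
    exact ⟨_, ⟨coboundary r, ⟨hr', r, rfl⟩, rfl⟩, mkQ_image_cocommutatorClass hr'⟩
  · rintro _ ⟨p, -, rfl⟩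
    exact hr.exists_countable_strata p
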